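/- Let $(M,g)$ be a smooth $n$-dimensional Riemannian manifold with Levi-Civita connection $\dot\nabla$, and let $\tau\colon TM\to M$ be its tangent bundle. For $y\in TM$ and $X\in T_{\tau(y)}M$ let $X^V_y,X^H_y\in T_yTM$ be the vertical lift and the horizontal lift (with respect to $\dot\nabla$) of $X$, and let $t=\tfrac12 g_{\tau(y)}(y,y)$ be the energy density. Let $a_1,\dots,a_4,b_1,\dots,b_4,c_1,c_2,c_3,d_1,d_2,d_3$ be smooth real functions on $[0,\infty)$. Let $J$ be the tensor field of type $(1,1)$ on $TM$ given by $$JX^H_y=a_1(t)X^V_y+b_1(t)g(X,y)y^V_y+a_4(t)X^H_y+b_4(t)g(X,y)y^H_y,$$ $$JX^V_y=a_3(t)X^V_y+b_3(t)g(X,y)y^V_y-a_2(t)X^H_y-b_2(t)g(X,y)y^H_y,$$ and let $G$ be the field of symmetric bilinear forms on $TM$ given by $$G(X^H_y,Y^H_y)=c_1(t)g(X,Y)+d_1(t)g(X,y)g(Y,y),$$ $$G(X^V_y,Y^V_y)=c_2(t)g(X,Y)+d_2(t)g(X,y)g(Y,y),$$ $$G(X^V_y,Y^H_y)=c_3(t)g(X,Y)+d_3(t)g(X,y)g(Y,y).$$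 Assume that $(G,J)$ is an almost anti-Hermitian structure, i.e. that $J^2=-\mathrm{Id}$, that $G$ is non-degenerate, and that $G(JX,JY)=-G(X,Y)$ for all $X,Y$. Let $\nabla$ be the Levi-Civita connection of $G$ and put $F(X,Y,Z)=G((\nabla_XJ)Y,Z)$. Then $(TM,G,J)$ is complex anti-Hermitian (of class $\omega_1\oplus\omega_2$), i.e. $$F(X,Y,JZ)+F(Y,Z,JX)+F(Z,X,JY)=0\quad\text{for all smooth vector fields }X,Y,Z\text{ on }TM,$$ if and only if $J$ is integrable, i.e. its Nijenhuis tensor $$N_J(X,Y)=[JX,JY]-J[JX,Y]-J[X,JY]-[X,Y]$$ vanishes for all smooth vector fields $X,Y$ on $TM$. -/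

import Mathlib

open Bundle Manifold VectorField Set
open scoped ContDiff Topology

noncomputable section

namespace NaturalLift

section Connection

variable {E : Type*} [NormedAddCommGroup E] [NormedSpace ℝ E]
  {H : Type*} [TopologicalSpace H] (I : ModelWithCorners ℝ E H)
  {N : Type*} [TopologicalSpace N] [ChartedSpace H N]

/-- The derivative `v(f)` of a real function `f` at the point `p` along the tangent vector `v`. -/
def dirDeriv (f : N → ℝ) (p : N) (v : TangentSpace I p) : ℝ :=
  mfderiv I 𝓘(ℝ, ℝ) f p v

/-- The right-hand side of the Koszul formula, for a field `h` of symmetric bilinear forms: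
`X h(Y,Z) + Y h(X,Z) - Z h(X,Y) + h([X,Y],Z) - h([X,Z],Y) - h([Y,Z],X)` at the point `p`. -/
def koszul (h : ∀ p : N, TangentSpace I p → TangentSpace I p → ℝ)
    (X Y Z : ∀ p : N, TangentSpace I p) (p : N) : ℝ :=
  dirDeriv I (fun q => h q (Y q) (Z q)) p (X p)
    + dirDeriv I (fun q => h q (X q) (Z q)) p (Y p)
    - dirDeriv I (fun q => h q (X q) (Y q)) p (Z p)
    + h p (mlieBracket I X Y p) (Z p)
    - h p (mlieBracket I X Z p) (Y p)
    - h p (mlieBracket I Y Z p) (X p)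

/-- The Levi-Civita connection `∇_X Y` of a (semi-)Riemannian metric `h`: the value at `p` is the
tangent vector `w` with `2 h(w, z) = koszul(X, Y, Z)(p)` for every tangent vector `z` at `p`, where
`Z` is a vector field, smooth near `p`, with value `z` at `p` (here the one that is constant in the
preferred chart at `p`; the right-hand side depends on `Z` only through `z`). By non-degeneracy of
`h` there is exactly one such `w` when `X` and `Y` are smooth. -/
def leviCivita (h : ∀ p : N, TangentSpace I p → TangentSpace I p → ℝ) [IsManifold I 1 N]
    (X Y : ∀ p : N, TangentSpace I p) (p : N) : TangentSpace I p :=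
  Classical.epsilon fun w : TangentSpace I p =>
    ∀ z : TangentSpace I p, 2 * h p w z = koszul I h X Y (FiberBundle.extend E z) p

/-- A smooth vector field. -/
def IsSmoothField [IsManifold I 1 N] (X : ∀ p : N, TangentSpace I p) : Prop :=
  ContMDiff I I.tangent ∞ (fun p => (⟨p, X p⟩ : TangentBundle I N))

/-- `J` is an almost complex structure: `J² = -1`. -/
def IsAlmostComplex (J : ∀ p : N, TangentSpace I p → TangentSpace I p) : Prop :=
  ∀ (p : N) (ξ : TangentSpace I p), J p (J p ξ) = -ξ

/-- The bilinear forms `G` are non-degenerate. -/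
def IsNondegenerate (G : ∀ p : N, TangentSpace I p → TangentSpace I p → ℝ) : Prop :=
  ∀ (p : N) (ξ : TangentSpace I p), (∀ η : TangentSpace I p, G p ξ η = 0) → ξ = 0

/-- The anti-Hermitian (Norden) condition `G(Jξ, Jη) = -G(ξ, η)`. -/
def IsAntiHermitian (G : ∀ p : N, TangentSpace I p → TangentSpace I p → ℝ)
    (J : ∀ p : N, TangentSpace I p → TangentSpace I p) : Prop :=
  ∀ (p : N) (ξ η : TangentSpace I p), G p (J p ξ) (J p η) = -G p ξ η

/-- The Nijenhuis tensor `[JX,JY] - J[JX,Y] - J[X,JY] - [X,Y]` of `J`. -/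
def nijenhuis (J : ∀ p : N, TangentSpace I p → TangentSpace I p)
    (X Y : ∀ p : N, TangentSpace I p) (p : N) : TangentSpace I p :=
  mlieBracket I (fun q => J q (X q)) (fun q => J q (Y q)) p
    - J p (mlieBracket I (fun q => J q (X q)) Y p)
    - J p (mlieBracket I X (fun q => J q (Y q)) p)
    - mlieBracket I X Y p

/-- The almost complex structure `J` is integrable: its Nijenhuis tensor (torsion) vanishes. -/
def IsIntegrable [IsManifold I 1 N] (J : ∀ p : N, TangentSpace I p → TangentSpace I p) : Prop :=
  ∀ X Y : ∀ p : N, TangentSpace I p, IsSmoothField I X → IsSmoothField I Y →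
    ∀ p, nijenhuis I J X Y p = 0

/-- The tensor field `F(X,Y,Z) = G((∇_X J)Y, Z)`, where `∇` is the Levi-Civita connection of `G`
and `(∇_X J)Y = ∇_X(JY) - J(∇_X Y)`. -/
def tensorF [IsManifold I 1 N] (G : ∀ p : N, TangentSpace I p → TangentSpace I p → ℝ)
    (J : ∀ p : N, TangentSpace I p → TangentSpace I p)
    (X Y Z : ∀ p : N, TangentSpace I p) (p : N) : ℝ :=
  G p (leviCivita I G X (fun q => J q (Y q)) p - J p (leviCivita I G X Y p)) (Z p)

/-- `(G, J)` is complex anti-Hermitian (of class `ω₁ ⊕ ω₂`):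
`F(X,Y,JZ) + F(Y,Z,JX) + F(Z,X,JY) = 0` for all smooth vector fields `X`, `Y`, `Z`. -/
def IsComplexAntiHermitian [IsManifold I 1 N]
    (G : ∀ p : N, TangentSpace I p → TangentSpace I p → ℝ)
    (J : ∀ p : N, TangentSpace I p → TangentSpace I p) : Prop :=
  ∀ X Y Z : ∀ p : N, TangentSpace I p,
    IsSmoothField I X → IsSmoothField I Y → IsSmoothField I Z →
    ∀ p, tensorF I G J X Y (fun q => J q (Z q)) p
      + tensorF I G J Y Z (fun q => J q (X q)) p
      + tensorF I G J Z X (fun q => J q (Y q)) p = 0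

end Connection

/-- The coefficients `a₁,…,a₄, b₁,…,b₄` of a general natural tensor field of type `(1,1)`:
smooth functions on `[0, ∞)`. -/
structure CoeffJ where
  (a₁ a₂ a₃ a₄ b₁ b₂ b₃ b₄ : ℝ → ℝ)
  smooth_a₁ : ContDiffOn ℝ ∞ a₁ (Ici 0)
  smooth_a₂ : ContDiffOn ℝ ∞ a₂ (Ici 0)
  smooth_a₃ : ContDiffOn ℝ ∞ a₃ (Ici 0)
  smooth_a₄ : ContDiffOn ℝ ∞ a₄ (Ici 0)
  smooth_b₁ : ContDiffOn ℝ ∞ b₁ (Ici 0)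
  smooth_b₂ : ContDiffOn ℝ ∞ b₂ (Ici 0)
  smooth_b₃ : ContDiffOn ℝ ∞ b₃ (Ici 0)
  smooth_b₄ : ContDiffOn ℝ ∞ b₄ (Ici 0)

/-- The coefficients `c₁, c₂, c₃, d₁, d₂, d₃` of a general natural metric: smooth functions on
`[0, ∞)`. -/
structure CoeffG where
  (c₁ c₂ c₃ d₁ d₂ d₃ : ℝ → ℝ)
  smooth_c₁ : ContDiffOn ℝ ∞ c₁ (Ici 0)
  smooth_c₂ : ContDiffOn ℝ ∞ c₂ (Ici 0)
  smooth_c₃ : ContDiffOn ℝ ∞ c₃ (Ici 0)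
  smooth_d₁ : ContDiffOn ℝ ∞ d₁ (Ici 0)
  smooth_d₂ : ContDiffOn ℝ ∞ d₂ (Ici 0)
  smooth_d₃ : ContDiffOn ℝ ∞ d₃ (Ici 0)

section TangentBundle

variable {E : Type*} [NormedAddCommGroup E] [NormedSpace ℝ E]
  {H : Type*} [TopologicalSpace H] {I : ModelWithCorners ℝ E H}
  {M : Type*} [TopologicalSpace M] [ChartedSpace H M] [IsManifold I ∞ M]

/-- The vertical lift `v^V` at `p = (x, y) ∈ TM` of `v ∈ T_x M`: the image of `v` under the
differential at `y` of the inclusion `T_x M → TM` of the fibre. -/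
def verticalLift (p : TangentBundle I M) (v : TangentSpace I p.proj) :
    TangentSpace I.tangent p :=
  mfderiv 𝓘(ℝ, E) I.tangent (fun w : E => (⟨p.proj, w⟩ : TangentBundle I M)) p.snd v

/-- The differential at `p ∈ TM` of the projection `τ : TM → M`. -/
def dproj (p : TangentBundle I M) (ξ : TangentSpace I.tangent p) : TangentSpace I p.proj :=
  mfderiv I.tangent I (fun q : TangentBundle I M => q.proj) p ξ

/-- For `p = (x, y) ∈ TM` and `v ∈ T_x M`: the image `dY(v)` of `v` under the differential of the
map `Y : M → TM`, where `Y` is the vector field near `x` with `Y(x) = y` that is constant in the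
preferred chart at `x`. The point `Y(x)` equals `p`, though not by definition; both tangent spaces
are the same copy of `E × E`, whence the type ascription. -/
def sectionDeriv (p : TangentBundle I M) (v : TangentSpace I p.proj) : TangentSpace I.tangent p :=
  (mfderiv I I.tangent
    (fun x : M => (⟨x, FiberBundle.extend E p.snd x⟩ : TangentBundle I M)) p.proj v :)

variable (g : ContMDiffRiemannianMetric I ∞ E (fun x : M => TangentSpace I x))

/-- The horizontal lift `v^H` at `p = (x, y) ∈ TM` of `v ∈ T_x M`, for the Levi-Civita connection
`∇` of `g`: it is `dY(v) - (∇_v Y)^V`, for a vector field `Y` that is smooth near `x` with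
`Y(x) = y`, regarded as a map `M → TM`. (Here `Y` and a field with value `v` at `x` are taken
constant in the preferred chart at `x`, so that in this chart `v^H = (v, -Γ(v, y))`; the result does
not depend on the choice.) -/
def horizontalLift (p : TangentBundle I M) (v : TangentSpace I p.proj) :
    TangentSpace I.tangent p :=
  sectionDeriv p v - verticalLift p
    (leviCivita I (fun x u w => g.inner x u w)
      (FiberBundle.extend E v) (FiberBundle.extend E p.snd) p.proj)

/-- The vertical component of `ξ ∈ T_p TM` in the splitting `TTM = VTM ⊕ HTM`: the vector
`w ∈ T_x M` with `ξ = w^V + (dτ(ξ))^H`. -/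
def connector (p : TangentBundle I M) (ξ : TangentSpace I.tangent p) : TangentSpace I p.proj :=
  Classical.epsilon fun w : TangentSpace I p.proj =>
    ξ = verticalLift p w + horizontalLift g p (dproj p ξ)

/-- The energy density `t = g(y, y) / 2`. -/
def energy (p : TangentBundle I M) : ℝ := g.inner p.proj p.snd p.snd / 2

/-- The general natural tensor field `J` of type `(1,1)` on `TM`: for `ξ = u^H + w^V`, the vector
`J ξ = J u^H + J w^V` with
`J u^H = a₁ u^V + b₁ g(u,y) y^V + a₄ u^H + b₄ g(u,y) y^H`,
`J w^V = a₃ w^V + b₃ g(w,y) y^V - a₂ w^H - b₂ g(w,y) y^H`,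
the coefficients being taken at the energy density. -/
def naturalJ (k : CoeffJ) (p : TangentBundle I M) (ξ : TangentSpace I.tangent p) :
    TangentSpace I.tangent p :=
  let t := energy g p
  let y : TangentSpace I p.proj := p.snd
  let u := dproj p ξ
  let w := connector g p ξ
  let gu := g.inner p.proj u y
  let gw := g.inner p.proj w y
  (k.a₁ t • verticalLift p u + (k.b₁ t * gu) • verticalLift p y
      + k.a₄ t • horizontalLift g p u + (k.b₄ t * gu) • horizontalLift g p y)
    + (k.a₃ t • verticalLift p w + (k.b₃ t * gw) • verticalLift p y
      - k.a₂ t • horizontalLift g p w - (k.b₂ t * gw) • horizontalLift g p y)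

/-- The general natural field `G` of symmetric bilinear forms on `TM`, given by
`G(u^H, u'^H) = c₁ g(u,u') + d₁ g(u,y) g(u',y)`,
`G(w^V, w'^V) = c₂ g(w,w') + d₂ g(w,y) g(w',y)`,
`G(w^V, u^H) = G(u^H, w^V) = c₃ g(w,u) + d₃ g(w,y) g(u,y)`,
the coefficients being taken at the energy density. -/
def naturalG (k : CoeffG) (p : TangentBundle I M) (ξ η : TangentSpace I.tangent p) : ℝ :=
  let t := energy g p
  let y : TangentSpace I p.proj := p.snd
  let gx : TangentSpace I p.proj → TangentSpace I p.proj → ℝ := fun v v' => g.inner p.proj v v'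
  let u := dproj p ξ
  let w := connector g p ξ
  let u' := dproj p η
  let w' := connector g p η
  (k.c₁ t * gx u u' + k.d₁ t * gx u y * gx u' y)
    + (k.c₂ t * gx w w' + k.d₂ t * gx w y * gx w' y)
    + (k.c₃ t * gx w u' + k.d₃ t * gx w y * gx u' y)
    + (k.c₃ t * gx w' u + k.d₃ t * gx w' y * gx u y)

end TangentBundle

end NaturalLift

end

/-! The equivalence holds on any almost anti-Hermitian manifold; the natural form of `G` and `J`
matters only for their smoothness. Write S(X,Y,Z) for the cyclic sum of F(X,Y,JZ), that is
`cyclicF`. Since G(JU,JV) = -G(U,V), one has F(X,Y,JZ) = G(∇_X JY, JZ) + G(∇_X Y, Z), so Koszul's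
formula gives `two_mul_tensorF`, and compatibility of ∇ with G makes F(X,Y,JZ) skew in Y and Z.
Expanding everything in Koszul terms yields `metric_nijenhuis`: G(N_J(X,Y),Z) = S(JX,JY,Z) -
S(X,Y,Z). If S = 0, then N_J = 0 by non-degeneracy, provided every tangent vector extends to a
global smooth field. If N_J = 0, then S is unchanged when J is inserted in two slots; by cyclicity
any two slots will do. Using the three pairs of slots in turn, S(X,Y,Z) = S(JX,JY,Z) = S(JX,JJY,JZ)
= S(X,JJY,Z) = -S(X,Y,Z), hence S = 0. This is `isComplexAntiHermitian_iff_isIntegrable`. What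
remains is to check that `naturalG` is a differentiable metric, that `naturalJ` preserves smooth
fields, and that TM is Hausdorff, so that cut-off functions exist. The first two rest on
`smoothAlongAt_tangentBundle_iff`: a field on TM is smooth exactly when its horizontal and vertical
parts are. That in turn follows from the local formula K = dy + Γ(dx, y) for the vertical part, with
Christoffel symbols shown to be smooth through Koszul's formula. -/

noncomputable section

namespace NaturalLift

/-! ### Koszul's formula and the existence of the Levi-Civita connection. -/

section Koszul

variable {E : Type*} [NormedAddCommGroup E] [NormedSpace ℝ E]
  {H : Type*} [TopologicalSpace H] {I : ModelWithCorners ℝ E H}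
  {N : Type*} [TopologicalSpace N] [ChartedSpace H N]

/-- A section of the tangent bundle is differentiable at `p`. -/
abbrev DiffFieldAt [IsManifold I 1 N] (X : ∀ p : N, TangentSpace I p) (p : N) : Prop :=
  MDifferentiableAt I I.tangent (fun q => (⟨q, X q⟩ : TangentBundle I N)) p

lemma dirDeriv_add {f f' : N → ℝ} {p : N} (hf : MDifferentiableAt I 𝓘(ℝ, ℝ) f p)
    (hf' : MDifferentiableAt I 𝓘(ℝ, ℝ) f' p) (v : TangentSpace I p) :
    dirDeriv I (fun q => f q + f' q) p v = dirDeriv I f p v + dirDeriv I f' p v :=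
  congrArg (fun L => L v) (mvfderiv_add hf hf')

lemma dirDeriv_mul {f f' : N → ℝ} {p : N} (hf : MDifferentiableAt I 𝓘(ℝ, ℝ) f p)
    (hf' : MDifferentiableAt I 𝓘(ℝ, ℝ) f' p) (v : TangentSpace I p) :
    dirDeriv I (fun q => f q * f' q) p v = f p * dirDeriv I f' p v + dirDeriv I f p v * f' p := by
  have := congrArg (fun L => L v) (mvfderiv_mul hf hf')
  refine this.trans ?_
  simp only [add_apply, smul_apply, smul_eq_mul]
  change _ * dirDeriv I f' p v + _ * dirDeriv I f p v = _
  ring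

lemma dirDeriv_neg (f : N → ℝ) (p : N) (v : TangentSpace I p) :
    dirDeriv I (fun q => -f q) p v = -dirDeriv I f p v :=
  congrArg (fun L => L v) (mvfderiv_neg (g := f) (x := p))

lemma dirDeriv_vec_add (f : N → ℝ) (p : N) (v w : TangentSpace I p) :
    dirDeriv I f p (v + w) = dirDeriv I f p v + dirDeriv I f p w :=
  map_add (mfderiv I 𝓘(ℝ, ℝ) f p) v w

lemma dirDeriv_vec_smul (f : N → ℝ) (p : N) (c : ℝ) (v : TangentSpace I p) :
    dirDeriv I f p (c • v) = c * dirDeriv I f p v :=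
  map_smul (mfderiv I 𝓘(ℝ, ℝ) f p) c v

/-- A differentiable field of non-degenerate symmetric bilinear forms. -/
structure IsMetric [IsManifold I 1 N]
    (h : ∀ p : N, TangentSpace I p → TangentSpace I p → ℝ) : Prop where
  add_left : ∀ p u v w, h p (u + v) w = h p u w + h p v w
  smul_left : ∀ p (c : ℝ) u w, h p (c • u) w = c * h p u w
  symm : ∀ p u v, h p u v = h p v u
  nondeg : IsNondegenerate I h
  mdiff : ∀ p (X Y : ∀ q : N, TangentSpace I q), DiffFieldAt X p → DiffFieldAt Y p →
    MDifferentiableAt I 𝓘(ℝ, ℝ) (fun q => h q (X q) (Y q)) p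

namespace IsMetric

variable [IsManifold I ∞ N] {h : ∀ p : N, TangentSpace I p → TangentSpace I p → ℝ}

lemma add_right (hh : IsMetric h) (p : N) (u v w : TangentSpace I p) :
    h p u (v + w) = h p u v + h p u w := by
  rw [hh.symm, hh.add_left, hh.symm _ v, hh.symm _ w]

lemma smul_right (hh : IsMetric h) (p : N) (c : ℝ) (u v : TangentSpace I p) :
    h p u (c • v) = c * h p u v := by
  rw [hh.symm, hh.smul_left, hh.symm]

lemma neg_left (hh : IsMetric h) (p : N) (u v : TangentSpace I p) : h p (-u) v = -h p u v := by
  have := hh.smul_left p (-1) u v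
  simpa using this

lemma neg_right (hh : IsMetric h) (p : N) (u v : TangentSpace I p) : h p u (-v) = -h p u v := by
  rw [hh.symm, hh.neg_left, hh.symm]

lemma sub_left (hh : IsMetric h) (p : N) (u v w : TangentSpace I p) :
    h p (u - v) w = h p u w - h p v w := by
  rw [sub_eq_add_neg, hh.add_left, hh.neg_left, sub_eq_add_neg]

lemma ext (hh : IsMetric h) {p : N} {u v : TangentSpace I p} (huv : ∀ w, h p u w = h p v w) :
    u = v :=
  sub_eq_zero.1 (hh.nondeg p _ fun w => by rw [hh.sub_left, huv, sub_self])

/-- Koszul's formula, exchanging the last two arguments. -/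
lemma koszul_swap_right (hh : IsMetric h) (X Y Z : ∀ q : N, TangentSpace I q) (p : N) :
    koszul I h X Y Z p + koszul I h X Z Y p = 2 * dirDeriv I (fun q => h q (Y q) (Z q)) p (X p) := by
  simp only [koszul]
  rw [mlieBracket_swap_apply (V := Y) (W := Z), hh.neg_left,
    show (fun q => h q (Z q) (Y q)) = fun q => h q (Y q) (Z q) from funext fun q => hh.symm _ _ _]
  ring

/-- Koszul's formula, exchanging the first two arguments. -/
lemma koszul_swap_left (hh : IsMetric h) (X Y Z : ∀ q : N, TangentSpace I q) (p : N) :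
    koszul I h X Y Z p - koszul I h Y X Z p = 2 * h p (mlieBracket I X Y p) (Z p) := by
  simp only [koszul]
  rw [mlieBracket_swap_apply (V := Y) (W := X), hh.neg_left,
    show (fun q => h q (Y q) (X q)) = fun q => h q (X q) (Y q) from funext fun q => hh.symm _ _ _]
  ring

/-- Non-degeneracy makes u ↦ h(u, ·) injective into the dual, hence bijective by equality of
dimensions. -/
lemma exists_eq_of_linear [FiniteDimensional ℝ E] (hh : IsMetric h) (p : N)
    (φ : TangentSpace I p →ₗ[ℝ] ℝ) : ∃ w, ∀ z, h p w z = φ z := by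
  have : FiniteDimensional ℝ (TangentSpace I p) := inferInstanceAs (FiniteDimensional ℝ E)
  let B : TangentSpace I p →ₗ[ℝ] Module.Dual ℝ (TangentSpace I p) :=
    LinearMap.mk₂ ℝ (h p) (hh.add_left p) (hh.smul_left p) (hh.add_right p) (hh.smul_right p)
  have hB : Function.Injective B :=
    (injective_iff_map_eq_zero B).2 fun u hu => hh.nondeg p u fun v => LinearMap.congr_fun hu v
  obtain ⟨w, hw⟩ :=
    (LinearMap.injective_iff_surjective_of_finrank_eq_finrank Subspace.dual_finrank_eq.symm).1 hB φ
  exact ⟨w, fun z => LinearMap.congr_fun hw z⟩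

variable [CompleteSpace E]

lemma koszul_add_right (hh : IsMetric h) {p : N} {X Y Z Z' : ∀ q : N, TangentSpace I q}
    (hX : DiffFieldAt X p) (hY : DiffFieldAt Y p) (hZ : DiffFieldAt Z p)
    (hZ' : DiffFieldAt Z' p) :
    koszul I h X Y (Z + Z') p = koszul I h X Y Z p + koszul I h X Y Z' p := by
  have : IsManifold I 2 N := .of_le (n := ∞) (by norm_cast)
  simp only [koszul, Pi.add_apply, hh.add_right]
  rw [dirDeriv_add (hh.mdiff _ _ _ hY hZ) (hh.mdiff _ _ _ hY hZ'),
    dirDeriv_add (hh.mdiff _ _ _ hX hZ) (hh.mdiff _ _ _ hX hZ'), dirDeriv_vec_add,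
    mlieBracket_add_right hZ hZ', mlieBracket_add_right hZ hZ', hh.add_left, hh.add_left]
  ring

/-- The derivatives X(f) and Y(f) from the product rule cancel against those from [X, fZ] and [Y,
fZ]. -/
lemma koszul_smul_right (hh : IsMetric h) {p : N} {X Y Z : ∀ q : N, TangentSpace I q}
    {f : N → ℝ} (hf : MDifferentiableAt I 𝓘(ℝ, ℝ) f p)
    (hX : DiffFieldAt X p) (hY : DiffFieldAt Y p) (hZ : DiffFieldAt Z p) :
    koszul I h X Y (f • Z) p = f p * koszul I h X Y Z p := by
  have : IsManifold I 2 N := .of_le (n := ∞) (by norm_cast)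
  simp only [koszul, Pi.smul_apply', hh.smul_right]
  rw [dirDeriv_mul hf (hh.mdiff _ _ _ hY hZ), dirDeriv_mul hf (hh.mdiff _ _ _ hX hZ),
    dirDeriv_vec_smul, mlieBracket_smul_right hf hZ, mlieBracket_smul_right hf hZ,
    hh.add_left, hh.add_left, hh.smul_left, hh.smul_left, hh.smul_left, hh.smul_left]
  change _ - _ + _ - (dirDeriv I f p (X p) * _ + _) - (dirDeriv I f p (Y p) * _ + _) = _
  rw [hh.symm p (Z p), hh.symm p (Z p)]
  ring

/-- `koszul_swap_right` reduces the middle slot to the last one, at the cost of a derivative of h(Y,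
Z); the same reduction gives the Leibniz rule below. The first slot is then reduced to the middle
one by `koszul_swap_left`. -/
lemma koszul_add_middle (hh : IsMetric h) {p : N} {X Y Y' Z : ∀ q : N, TangentSpace I q}
    (hX : DiffFieldAt X p) (hY : DiffFieldAt Y p) (hY' : DiffFieldAt Y' p)
    (hZ : DiffFieldAt Z p) :
    koszul I h X (Y + Y') Z p = koszul I h X Y Z p + koszul I h X Y' Z p := by
  have h1 := hh.koszul_swap_right X (Y + Y') Z p
  have h2 := hh.koszul_swap_right X Y Z p
  have h3 := hh.koszul_swap_right X Y' Z p
  simp only [Pi.add_apply, hh.add_left] at h1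
  rw [dirDeriv_add (hh.mdiff _ _ _ hY hZ) (hh.mdiff _ _ _ hY' hZ),
    hh.koszul_add_right hX hZ hY hY'] at h1
  linarith

lemma koszul_smul_middle (hh : IsMetric h) {p : N} {X Y Z : ∀ q : N, TangentSpace I q}
    {f : N → ℝ} (hf : MDifferentiableAt I 𝓘(ℝ, ℝ) f p)
    (hX : DiffFieldAt X p) (hY : DiffFieldAt Y p) (hZ : DiffFieldAt Z p) :
    koszul I h X (f • Y) Z p
      = f p * koszul I h X Y Z p + 2 * dirDeriv I f p (X p) * h p (Y p) (Z p) := by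
  have h1 := hh.koszul_swap_right X (f • Y) Z p
  have h2 := hh.koszul_swap_right X Y Z p
  simp only [Pi.smul_apply', hh.smul_left] at h1
  rw [dirDeriv_mul hf (hh.mdiff _ _ _ hY hZ), hh.koszul_smul_right hf hX hZ hY] at h1
  linear_combination h1 - f p * h2

lemma koszul_add_left (hh : IsMetric h) {p : N} {X X' Y Z : ∀ q : N, TangentSpace I q}
    (hX : DiffFieldAt X p) (hX' : DiffFieldAt X' p) (hY : DiffFieldAt Y p)
    (hZ : DiffFieldAt Z p) :
    koszul I h (X + X') Y Z p = koszul I h X Y Z p + koszul I h X' Y Z p := by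
  have : IsManifold I 2 N := .of_le (n := ∞) (by norm_cast)
  have h1 := hh.koszul_swap_left (X + X') Y Z p
  have h2 := hh.koszul_swap_left X Y Z p
  have h3 := hh.koszul_swap_left X' Y Z p
  rw [mlieBracket_add_left hX hX', hh.koszul_add_middle hY hX hX' hZ, hh.add_left] at h1
  linarith

lemma koszul_smul_left (hh : IsMetric h) {p : N} {X Y Z : ∀ q : N, TangentSpace I q}
    {f : N → ℝ} (hf : MDifferentiableAt I 𝓘(ℝ, ℝ) f p)
    (hX : DiffFieldAt X p) (hY : DiffFieldAt Y p) (hZ : DiffFieldAt Z p) :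
    koszul I h (f • X) Y Z p = f p * koszul I h X Y Z p := by
  have : IsManifold I 2 N := .of_le (n := ∞) (by norm_cast)
  have h1 := hh.koszul_swap_left (f • X) Y Z p
  have h2 := hh.koszul_swap_left X Y Z p
  rw [mlieBracket_smul_left hf hX, hh.koszul_smul_middle hf hY hX hZ, hh.add_left,
    hh.smul_left, hh.smul_left] at h1
  change _ = 2 * (-dirDeriv I f p (Y p) * _ + _) at h1
  linear_combination h1 - f p * h2

lemma tensorialAt_koszul_right (hh : IsMetric h) {p : N} {X Y : ∀ q : N, TangentSpace I q}
    (hX : DiffFieldAt X p) (hY : DiffFieldAt Y p) :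
    TensorialAt I E (fun Z : ∀ q : N, TangentSpace I q => koszul I h X Y Z p) p where
  smul hf hZ := hh.koszul_smul_right hf hX hY hZ
  add hZ hZ' := hh.koszul_add_right hX hY hZ hZ'

lemma tensorialAt_koszul_left (hh : IsMetric h) {p : N} {Y Z : ∀ q : N, TangentSpace I q}
    (hY : DiffFieldAt Y p) (hZ : DiffFieldAt Z p) :
    TensorialAt I E (fun X : ∀ q : N, TangentSpace I q => koszul I h X Y Z p) p where
  smul hf hX := hh.koszul_smul_left hf hX hY hZ
  add hX hX' := hh.koszul_add_left hX hX' hY hZ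

/-- Tensoriality in Z does two things: it makes the right-hand side a linear form in z, so that the
vector chosen by `Classical.epsilon` does satisfy its specification, and it allows any
differentiable Z in place of the chart-constant extension. -/
lemma two_mul_leviCivita [FiniteDimensional ℝ E] (hh : IsMetric h) {p : N}
    {X Y Z : ∀ q : N, TangentSpace I q}
    (hX : DiffFieldAt X p) (hY : DiffFieldAt Y p) (hZ : DiffFieldAt Z p) :
    2 * h p (leviCivita I h X Y p) (Z p) = koszul I h X Y Z p := by
  have hT := hh.tensorialAt_koszul_right hX hY
  obtain ⟨w, hw⟩ := hh.exists_eq_of_linear p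
    ((1 / 2 : ℝ) • (TensorialAt.mkHom _ p hT : TangentSpace I p →ₗ[ℝ] ℝ))
  have hex : ∃ w : TangentSpace I p, ∀ z : TangentSpace I p,
      2 * h p w z = koszul I h X Y (FiberBundle.extend E z) p := by
    refine ⟨w, fun z => ?_⟩
    rw [hw, ← TensorialAt.mkHom_apply_eq_extend hT z]
    simp
  have := Classical.epsilon_spec hex (Z p)
  refine this.trans ?_
  exact hT.pointwise (FiberBundle.mdifferentiableAt_extend ..) hZ (by simp)

end IsMetric

end Koszul

/-! ### The equivalence on an arbitrary almost anti-Hermitian manifold. -/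

section Norden

variable {E : Type*} [NormedAddCommGroup E] [NormedSpace ℝ E]
  {H : Type*} [TopologicalSpace H] {I : ModelWithCorners ℝ E H}
  {N : Type*} [TopologicalSpace N] [ChartedSpace H N] [IsManifold I ∞ N]
  {h : ∀ p : N, TangentSpace I p → TangentSpace I p → ℝ}
  {J : ∀ p : N, TangentSpace I p → TangentSpace I p}

lemma IsSmoothField.diffFieldAt {X : ∀ p : N, TangentSpace I p} (hX : IsSmoothField I X) (p : N) :
    DiffFieldAt X p :=
  (hX p).mdifferentiableAt (by simp)

/-- In an almost anti-Hermitian manifold the endomorphism `J` is self-adjoint. -/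
lemma IsAntiHermitian.apply_left (hh : IsMetric h) (hJ : IsAlmostComplex I J)
    (hhJ : IsAntiHermitian I h J) (p : N) (u v : TangentSpace I p) :
    h p (J p u) v = h p u (J p v) := by
  have := hhJ p u (J p v)
  rw [hJ, hh.neg_right] at this
  linarith

variable (h J) in
/-- The cyclic sum of `F(X, Y, JZ)`. -/
def cyclicF (X Y Z : ∀ p : N, TangentSpace I p) (p : N) : ℝ :=
  tensorF I h J X Y (fun q => J q (Z q)) p + tensorF I h J Y Z (fun q => J q (X q)) p
    + tensorF I h J Z X (fun q => J q (Y q)) p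

lemma cyclicF_rotate (X Y Z : ∀ p : N, TangentSpace I p) (p : N) :
    cyclicF h J X Y Z p = cyclicF h J Y Z X p := by
  simp only [cyclicF]; ring

variable [FiniteDimensional ℝ E]

/-- The tensor `F(X, Y, JZ)` of an almost anti-Hermitian manifold, by Koszul's formula. -/
lemma two_mul_tensorF (hh : IsMetric h)
    (hhJ : IsAntiHermitian I h J)
    (hsm : ∀ X : ∀ p : N, TangentSpace I p, IsSmoothField I X → IsSmoothField I fun q => J q (X q))
    {X Y Z : ∀ p : N, TangentSpace I p} (hX : IsSmoothField I X) (hY : IsSmoothField I Y)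
    (hZ : IsSmoothField I Z) (p : N) :
    2 * tensorF I h J X Y (fun q => J q (Z q)) p
      = koszul I h X (fun q => J q (Y q)) (fun q => J q (Z q)) p + koszul I h X Y Z p := by
  have : CompleteSpace E := FiniteDimensional.complete ℝ E
  have h1 := hh.two_mul_leviCivita (hX.diffFieldAt p) ((hsm Y hY).diffFieldAt p)
    ((hsm Z hZ).diffFieldAt p)
  have h2 := hh.two_mul_leviCivita (hX.diffFieldAt p) (hY.diffFieldAt p) (hZ.diffFieldAt p)
  rw [tensorF, hh.sub_left, hhJ]
  linarith

/-- Symmetrizing the two Koszul terms in Y and Z leaves 2X(h(JY,JZ)) + 2X(h(Y,Z)), which vanishes by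
the anti-Hermitian condition. -/
lemma two_mul_tensorF_swap (hh : IsMetric h)
    (hhJ : IsAntiHermitian I h J)
    (hsm : ∀ X : ∀ p : N, TangentSpace I p, IsSmoothField I X → IsSmoothField I fun q => J q (X q))
    {X Y Z : ∀ p : N, TangentSpace I p} (hX : IsSmoothField I X) (hY : IsSmoothField I Y)
    (hZ : IsSmoothField I Z) (p : N) :
    tensorF I h J X Y (fun q => J q (Z q)) p = -tensorF I h J X Z (fun q => J q (Y q)) p := by
  have h1 := two_mul_tensorF hh hhJ hsm hX hY hZ p
  have h2 := two_mul_tensorF hh hhJ hsm hX hZ hY p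
  have h3 := hh.koszul_swap_right X Y Z p
  have h4 := hh.koszul_swap_right X (fun q => J q (Y q)) (fun q => J q (Z q)) p
  have h5 : (fun q => h q (J q (Y q)) (J q (Z q))) = fun q => -h q (Y q) (Z q) :=
    funext fun q => hhJ q _ _
  rw [h5, dirDeriv_neg] at h4
  linarith

lemma koszul_neg_left (hh : IsMetric h) {X Y Z : ∀ p : N, TangentSpace I p} {p : N}
    (hX : DiffFieldAt X p) (hY : DiffFieldAt Y p) (hZ : DiffFieldAt Z p) :
    koszul I h (fun q => -X q) Y Z p = -koszul I h X Y Z p := by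
  have : CompleteSpace E := FiniteDimensional.complete ℝ E
  have := hh.koszul_smul_left (f := fun _ => (-1 : ℝ)) mdifferentiableAt_const hX hY hZ
  rw [show (fun _ : N => (-1 : ℝ)) • X = fun q => -X q from funext fun q => by simp] at this
  linarith

lemma koszul_neg_middle (hh : IsMetric h) {X Y Z : ∀ p : N, TangentSpace I p} {p : N}
    (hX : DiffFieldAt X p) (hY : DiffFieldAt Y p) (hZ : DiffFieldAt Z p) :
    koszul I h X (fun q => -Y q) Z p = -koszul I h X Y Z p := by
  have : CompleteSpace E := FiniteDimensional.complete ℝ E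
  have := hh.koszul_smul_right (f := fun _ => (-1 : ℝ)) mdifferentiableAt_const hX hZ hY
  rw [show (fun _ : N => (-1 : ℝ)) • Y = fun q => -Y q from funext fun q => by simp] at this
  have h1 := hh.koszul_swap_right X Y Z p
  have h2 := hh.koszul_swap_right X (fun q => -Y q) Z p
  have h3 : (fun q => h q (-Y q) (Z q)) = fun q => -h q (Y q) (Z q) :=
    funext fun q => hh.neg_left q _ _
  rw [h3, dirDeriv_neg] at h2
  linarith

/-- The Nijenhuis tensor in terms of the cyclic sums of `F`. -/
lemma metric_nijenhuis (hh : IsMetric h) (hJ : IsAlmostComplex I J)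
    (hhJ : IsAntiHermitian I h J)
    (hsm : ∀ X : ∀ p : N, TangentSpace I p, IsSmoothField I X → IsSmoothField I fun q => J q (X q))
    {X Y Z : ∀ p : N, TangentSpace I p} (hX : IsSmoothField I X) (hY : IsSmoothField I Y)
    (hZ : IsSmoothField I Z) (p : N) :
    h p (nijenhuis I J X Y p) (Z p)
      = cyclicF h J (fun q => J q (X q)) (fun q => J q (Y q)) Z p - cyclicF h J X Y Z p := by
  have hJX := hsm X hX
  have hJY := hsm Y hY
  have hJZ := hsm Z hZ
  have hJJ (W : ∀ p : N, TangentSpace I p) : (fun q => J q (J q (W q))) = fun q => -W q :=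
    funext fun q => hJ q _
  have hn : h p (nijenhuis I J X Y p) (Z p)
      = h p (mlieBracket I (fun q => J q (X q)) (fun q => J q (Y q)) p) (Z p)
        - h p (mlieBracket I (fun q => J q (X q)) Y p) (J p (Z p))
        - h p (mlieBracket I X (fun q => J q (Y q)) p) (J p (Z p))
        - h p (mlieBracket I X Y p) (Z p) := by
    rw [nijenhuis, hh.sub_left, hh.sub_left, hh.sub_left, IsAntiHermitian.apply_left hh hJ hhJ,
      IsAntiHermitian.apply_left hh hJ hhJ]
  rw [hn, cyclicF, cyclicF]
  have b1 := hh.koszul_swap_left (fun q => J q (X q)) (fun q => J q (Y q)) Z p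
  have b2 := hh.koszul_swap_left (fun q => J q (X q)) Y (fun q => J q (Z q)) p
  have b3 := hh.koszul_swap_left X (fun q => J q (Y q)) (fun q => J q (Z q)) p
  have b4 := hh.koszul_swap_left X Y Z p
  have d {A B C : ∀ p : N, TangentSpace I p} (hA : IsSmoothField I A) (hB : IsSmoothField I B)
      (hC : IsSmoothField I C) := two_mul_tensorF hh hhJ hsm hA hB hC p
  have s {A B C : ∀ p : N, TangentSpace I p} (hA : IsSmoothField I A) (hB : IsSmoothField I B)
      (hC : IsSmoothField I C) := two_mul_tensorF_swap hh hhJ hsm hA hB hC p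
  have e1 := d hJX hJY hZ
  have e2 := d hJY hJX hZ
  have e3 := d hX hY hZ
  have e4 := d hY hX hZ
  have e5 := d hZ hJX hJY
  have e6 := d hZ hX hY
  -- Skewness turns the second summand of each cyclic sum into one with Z last; its difference with
  -- the first summand then produces brackets through `koszul_swap_left`.
  have f1 := s hJY hZ hJX
  have f2 := s hY hZ hX
  simp only [hJJ] at e1 e2 e5 f1 ⊢
  rw [koszul_neg_middle hh (hJX.diffFieldAt p) (hY.diffFieldAt p) (hJZ.diffFieldAt p)] at e1
  rw [koszul_neg_middle hh (hJY.diffFieldAt p) (hX.diffFieldAt p) (hJZ.diffFieldAt p)] at e2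
  -- The two signs from J² = -1 cancel, so F(Z,JX,JJY) = F(Z,X,JY) and the third summands of the two
  -- cyclic sums drop out.
  have e5' : koszul I h Z (fun q => -X q) (fun q => -Y q) p = koszul I h Z X Y p := by
    have hnY : DiffFieldAt (fun q => -Y q) p := mdifferentiableAt_neg_section (hY.diffFieldAt p)
    rw [koszul_neg_middle hh (hZ.diffFieldAt p) (hX.diffFieldAt p) hnY]
    have g1 := hh.koszul_swap_right Z X (fun q => -Y q) p
    have g2 := hh.koszul_swap_right Z X Y p
    have g3 : (fun q => h q (X q) (-Y q)) = fun q => -h q (X q) (Y q) :=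
      funext fun q => hh.neg_right q _ _
    rw [g3, dirDeriv_neg,
      koszul_neg_middle hh (hZ.diffFieldAt p) (hY.diffFieldAt p) (hX.diffFieldAt p)] at g1
    linarith
  linarith

/-- An almost anti-Hermitian manifold is complex anti-Hermitian iff its almost complex structure
is integrable. -/
theorem isComplexAntiHermitian_iff_isIntegrable (hh : IsMetric h) (hJ : IsAlmostComplex I J)
    (hhJ : IsAntiHermitian I h J)
    (hsm : ∀ X : ∀ p : N, TangentSpace I p, IsSmoothField I X → IsSmoothField I fun q => J q (X q))
    (hext : ∀ (p : N) (v : TangentSpace I p), ∃ X, IsSmoothField I X ∧ X p = v) :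
    IsComplexAntiHermitian I h J ↔ IsIntegrable I J := by
  constructor
  · intro hS X Y hX hY p
    refine hh.nondeg p _ fun v => ?_
    obtain ⟨Z, hZ, rfl⟩ := hext p v
    rw [metric_nijenhuis hh hJ hhJ hsm hX hY hZ p]
    have h1 := hS _ _ _ hX hY hZ p
    have h2 := hS _ _ _ (hsm X hX) (hsm Y hY) hZ p
    simp only [cyclicF]
    linarith
  · intro hN
    have key {X Y Z : ∀ p : N, TangentSpace I p} (hX : IsSmoothField I X) (hY : IsSmoothField I Y)
        (hZ : IsSmoothField I Z) (p : N) :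
        cyclicF h J (fun q => J q (X q)) (fun q => J q (Y q)) Z p = cyclicF h J X Y Z p := by
      have h1 := metric_nijenhuis hh hJ hhJ hsm hX hY hZ p
      have h0 : h p 0 (Z p) = 0 := by simpa using hh.smul_left p 0 0 (Z p)
      rw [hN X Y hX hY p, h0] at h1
      linarith
    intro X Y Z hX hY hZ p
    change cyclicF h J X Y Z p = 0
    have hJX := hsm X hX
    have hJY := hsm Y hY
    have hJZ := hsm Z hZ
    have hJJY := hsm _ hJY
    have key₂ {X Y Z : ∀ p : N, TangentSpace I p} (hX : IsSmoothField I X)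
        (hY : IsSmoothField I Y) (hZ : IsSmoothField I Z) :
        cyclicF h J X (fun q => J q (Y q)) (fun q => J q (Z q)) p = cyclicF h J X Y Z p := by
      rw [cyclicF_rotate, key hY hZ hX, ← cyclicF_rotate]
    have key₃ {X Y Z : ∀ p : N, TangentSpace I p} (hX : IsSmoothField I X)
        (hY : IsSmoothField I Y) (hZ : IsSmoothField I Z) :
        cyclicF h J (fun q => J q (X q)) Y (fun q => J q (Z q)) p = cyclicF h J X Y Z p := by
      rw [← cyclicF_rotate, key hZ hX hY, cyclicF_rotate]
    -- Inserting J in slots 1-2, then 2-3, and removing it from slots 1-3, leaves J applied twice to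
    -- Y alone.
    have h1 : cyclicF h J X Y Z p
        = cyclicF h J X (fun q => J q (J q (Y q))) Z p := by
      rw [← key hX hY hZ p, ← key₂ hJX hJY hZ, key₃ hX hJJY hZ]
    have h2 : cyclicF h J X (fun q => J q (J q (Y q))) Z p = -cyclicF h J X Y Z p := by
      have hnY : DiffFieldAt (fun q => -Y q) p := mdifferentiableAt_neg_section (hY.diffFieldAt p)
      have hnJY : DiffFieldAt (fun q => -J q (Y q)) p :=
        mdifferentiableAt_neg_section (hJY.diffFieldAt p)
      have d {A B C : ∀ p : N, TangentSpace I p} (hA : IsSmoothField I A)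
        (hB : IsSmoothField I B) (hC : IsSmoothField I C) :=
        two_mul_tensorF hh hhJ hsm hA hB hC p
      have e1 := d hX hJJY hZ
      have e2 := d hJJY hZ hX
      have e3 := d hZ hX hJJY
      -- Skewness moves JJY out of the last slot, so that the sign of J² only has to be pulled out
      -- of the first two slots of the Koszul expression.
      have e3' := two_mul_tensorF_swap hh hhJ hsm hZ hX hJJY p
      have e4 := d hX hY hZ
      have e5 := d hY hZ hX
      have e6 := d hZ hX hY
      have e6' := two_mul_tensorF_swap hh hhJ hsm hZ hX hY p
      have e7 := d hZ hY hX
      have e8 := d hZ hJJY hX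
      have hJJ (W : ∀ p : N, TangentSpace I p) : (fun q => J q (J q (W q))) = fun q => -W q :=
        funext fun q => hJ q _
      have hJJJ : (fun q => J q (J q (J q (Y q)))) = fun q => -J q (Y q) :=
        funext fun q => hJ q _
      rw [cyclicF, cyclicF]
      rw [hJJJ, koszul_neg_middle hh (hX.diffFieldAt p) (hJY.diffFieldAt p) (hJZ.diffFieldAt p),
        hJJ, koszul_neg_middle hh (hX.diffFieldAt p) (hY.diffFieldAt p) (hZ.diffFieldAt p)] at e1
      rw [hJJ, koszul_neg_left hh (hY.diffFieldAt p) (hJZ.diffFieldAt p) (hJX.diffFieldAt p),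
        koszul_neg_left hh (hY.diffFieldAt p) (hZ.diffFieldAt p) (hX.diffFieldAt p)] at e2
      rw [hJJJ, koszul_neg_middle hh (hZ.diffFieldAt p) (hJY.diffFieldAt p) (hJX.diffFieldAt p),
        hJJ, koszul_neg_middle hh (hZ.diffFieldAt p) (hY.diffFieldAt p) (hX.diffFieldAt p)] at e8
      rw [hJJJ] at e3'
      rw [hJJ] at e3' ⊢
      rw [hJJJ]
      linarith
    linarith

end Norden

/-! ### Smoothness of derivatives, brackets and Koszul expressions. -/

section Smoothness

variable {E : Type*} [NormedAddCommGroup E] [NormedSpace ℝ E]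
  {H : Type*} [TopologicalSpace H] {I : ModelWithCorners ℝ E H}
  {N : Type*} [TopologicalSpace N] [ChartedSpace H N] [IsManifold I ∞ N]
  {E' : Type*} [NormedAddCommGroup E'] [NormedSpace ℝ E']
  {H' : Type*} [TopologicalSpace H'] {I' : ModelWithCorners ℝ E' H'}
  {N' : Type*} [TopologicalSpace N'] [ChartedSpace H' N'] [IsManifold I' ∞ N']
  {EM : Type*} [NormedAddCommGroup EM] [NormedSpace ℝ EM]
  {HM : Type*} [TopologicalSpace HM] {IM : ModelWithCorners ℝ EM HM}
  {P : Type*} [TopologicalSpace P] [ChartedSpace HM P] [IsManifold IM ∞ P]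
  {F : Type*} [NormedAddCommGroup F] [NormedSpace ℝ F]

/-- A vector field along a map `b` is smooth at `m`. -/
abbrev SmoothAlongAt (I : ModelWithCorners ℝ E H) [IsManifold I ∞ N]
    (IM : ModelWithCorners ℝ EM HM) (b : P → N) (v : ∀ m : P, TangentSpace I (b m)) (m : P) : Prop :=
  ContMDiffAt IM I.tangent ∞ (fun m => (⟨b m, v m⟩ : TangentBundle I N)) m

lemma contMDiffAt_mfderiv_apply {f : N → N'} {b : P → N} {v : ∀ m : P, TangentSpace I (b m)}
    {m : P} (hf : ContMDiffAt I I' ∞ f (b m)) (hv : SmoothAlongAt I IM b v m) :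
    SmoothAlongAt I' IM (fun m => f (b m)) (fun m => mfderiv I I' f (b m) (v m)) m := by
  have hb : ContMDiffAt IM I ∞ b m := (contMDiffAt_totalSpace.1 hv).1
  refine ContMDiffAt.clm_apply_of_inCoordinates (F₁ := E) (F₂ := E') (n := ∞)
    (ϕ := fun m => mfderiv I I' f (b m)) ?_ hv (hf.comp m hb)
  refine ContMDiffAt.mfderiv (n := ∞) (fun _ => f) b ?_ hb (by simp)
  exact ContMDiffAt.comp (m, b m) hf contMDiffAt_snd

lemma contMDiffAt_mfderiv_vec {f : N → F} {b : P → N} {v : ∀ m : P, TangentSpace I (b m)}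
    {m : P} (hf : ContMDiffAt I 𝓘(ℝ, F) ∞ f (b m)) (hv : SmoothAlongAt I IM b v m) :
    ContMDiffAt IM 𝓘(ℝ, F) ∞ (fun m => (mfderiv I 𝓘(ℝ, F) f (b m) (v m) : F)) m := by
  have := contMDiffAt_mfderiv_apply hf hv
  exact ContMDiffAt.comp m (contMDiff_snd_tangentBundle_modelSpace F 𝓘(ℝ, F)).contMDiffAt this

/-- A field of bilinear forms which is smooth on smooth vector fields. -/
def IsSmoothForm (h : ∀ p : N, TangentSpace I p → TangentSpace I p → ℝ) : Prop :=
  ∀ p (X Y : ∀ q : N, TangentSpace I q), SmoothAlongAt I I id X p → SmoothAlongAt I I id Y p →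
    ContMDiffAt I 𝓘(ℝ, ℝ) ∞ (fun q => h q (X q) (Y q)) p

lemma contMDiffAt_mlieBracket [CompleteSpace E] {X Y : ∀ q : N, TangentSpace I q} {p : N}
    (hX : SmoothAlongAt I I id X p) (hY : SmoothAlongAt I I id Y p) :
    SmoothAlongAt I I id (mlieBracket I X Y) p := by
  have : IsManifold I (minSmoothness ℝ 2) N :=
    .of_le (n := ∞) (by simp only [minSmoothness_of_isRCLikeNormedField]; norm_cast)
  have : IsManifold I (((⊤ : ℕ∞) : WithTop ℕ∞) + 1) N := inferInstanceAs (IsManifold I ∞ N)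
  exact ContMDiffAt.mlieBracket_vectorField (n := ⊤) (m := ⊤) hX hY (by simp)

lemma IsSmoothForm.contMDiffAt_koszul [CompleteSpace E]
    {h : ∀ p : N, TangentSpace I p → TangentSpace I p → ℝ} (hs : IsSmoothForm h)
    {X Y Z : ∀ q : N, TangentSpace I q} {p : N}
    (hX : SmoothAlongAt I I id X p) (hY : SmoothAlongAt I I id Y p)
    (hZ : SmoothAlongAt I I id Z p) :
    ContMDiffAt I 𝓘(ℝ, ℝ) ∞ (koszul I h X Y Z) p := by
  have hd {f : N → ℝ} {X : ∀ q : N, TangentSpace I q} (hf : ContMDiffAt I 𝓘(ℝ, ℝ) ∞ f p)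
      (hX : SmoothAlongAt I I id X p) :
      ContMDiffAt I 𝓘(ℝ, ℝ) ∞ (fun q => dirDeriv I f q (X q)) p :=
    contMDiffAt_mfderiv_vec (b := id) hf hX
  have hb {X Y : ∀ q : N, TangentSpace I q} (hX : SmoothAlongAt I I id X p)
      (hY : SmoothAlongAt I I id Y p) := contMDiffAt_mlieBracket hX hY
  exact (((((hd (hs _ _ _ hY hZ) hX).add (hd (hs _ _ _ hX hZ) hY)).sub
    (hd (hs _ _ _ hX hY) hZ)).add (hs _ _ _ (hb hX hY) hZ)).sub
    (hs _ _ _ (hb hX hZ) hY)).sub (hs _ _ _ (hb hY hZ) hX)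

end Smoothness

/-! ### The Riemannian metric in the chart-constant frame. -/

section Riemannian

variable {E : Type*} [NormedAddCommGroup E] [NormedSpace ℝ E]
  {H : Type*} [TopologicalSpace H] {I : ModelWithCorners ℝ E H}
  {M : Type*} [TopologicalSpace M] [ChartedSpace H M] [IsManifold I ∞ M]
  {EM : Type*} [NormedAddCommGroup EM] [NormedSpace ℝ EM]
  {HM : Type*} [TopologicalSpace HM] {IM : ModelWithCorners ℝ EM HM}
  {P : Type*} [TopologicalSpace P] [ChartedSpace HM P]
  (g : ContMDiffRiemannianMetric I ∞ E (fun x : M => TangentSpace I x))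

/-- The field of bilinear forms underlying a Riemannian metric. -/
abbrev metricForm (x : M) (u w : TangentSpace I x) : ℝ := g.inner x u w

lemma contMDiffAt_metricForm {b : P → M} {u w : ∀ m : P, TangentSpace I (b m)} {m : P}
    (hu : SmoothAlongAt I IM b u m) (hw : SmoothAlongAt I IM b w m) :
    ContMDiffAt IM 𝓘(ℝ, ℝ) ∞ (fun m => metricForm g (b m) (u m) (w m)) m := by
  have hb : ContMDiffAt IM I ∞ b m := (contMDiffAt_totalSpace.1 hu).1
  have : ContMDiffAt IM (I.prod 𝓘(ℝ)) ∞ (fun m =>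
      TotalSpace.mk' ℝ (E := Bundle.Trivial M ℝ) (b m) (g.inner (b m) (u m) (w m))) m := by
    apply ContMDiffAt.clm_bundle_apply₂ (F₁ := E) (F₂ := E)
    · exact ContMDiffAt.comp m g.contMDiff.contMDiffAt hb
    · exact hu
    · exact hw
  exact (contMDiffAt_totalSpace.1 this).2

lemma isSmoothForm_metricForm : IsSmoothForm (metricForm g) :=
  fun _ _ _ hX hY => contMDiffAt_metricForm g hX hY

lemma isMetric_metricForm : IsMetric (metricForm g) where
  add_left p u v w := congrArg (fun L => L w) (map_add (g.inner p) u v)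
  smul_left p c u w := congrArg (fun L => L w) (map_smul (g.inner p) c u)
  symm := g.symm
  nondeg p u hu := by
    by_contra h
    exact (g.pos p u h).ne' (hu u)
  mdiff p X Y hX hY := by
    have : MDifferentiableAt I (I.prod 𝓘(ℝ)) (fun m =>
        TotalSpace.mk' ℝ (E := Bundle.Trivial M ℝ) m (g.inner m (X m) (Y m))) p := by
      apply MDifferentiableAt.clm_bundle_apply₂ (F₁ := E) (F₂ := E)
      · exact g.contMDiff.contMDiffAt.mdifferentiableAt (by simp)
      · exact hX
      · exact hY
    exact ((mdifferentiableAt_totalSpace ..).1 this).2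

/-- The trivialization of the tangent bundle over the preferred chart at `x₀`. -/
abbrev tangentTriv (I : ModelWithCorners ℝ E H) [IsManifold I ∞ M] (x₀ : M) :=
  trivializationAt E (TangentSpace I : M → Type _) x₀

/-- The vector field constant in the preferred chart at `x₀`. -/
def constField (I : ModelWithCorners ℝ E H) [IsManifold I ∞ M] (x₀ : M) (c : E) (x : M) :
    TangentSpace I x :=
  (tangentTriv I x₀).symmL ℝ x c

lemma constField_apply {x₀ x : M} (hx : x ∈ (tangentTriv I x₀).baseSet) (c : E) :
    constField I x₀ c x = (tangentTriv I x₀).symm x c :=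
  (tangentTriv I x₀).symmL_apply hx c

lemma constField_add (x₀ : M) (c d : E) :
    constField I x₀ (c + d) = constField I x₀ c + constField I x₀ d :=
  funext fun x => map_add ((tangentTriv I x₀).symmL ℝ x) c d

lemma constField_smul (x₀ : M) (r : ℝ) (c : E) :
    constField I x₀ (r • c) = r • constField I x₀ c :=
  funext fun x => map_smul ((tangentTriv I x₀).symmL ℝ x) r c

lemma tangentTriv_constField {x₀ x : M} (hx : x ∈ (tangentTriv I x₀).baseSet) (c : E) :
    (tangentTriv I x₀ ⟨x, constField I x₀ c x⟩).2 = c := by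
  rw [constField_apply hx]
  exact congrArg Prod.snd ((tangentTriv I x₀).apply_mk_symm hx c)

lemma constField_tangentTriv {x₀ x : M} (hx : x ∈ (tangentTriv I x₀).baseSet)
    (v : TangentSpace I x) : constField I x₀ (tangentTriv I x₀ ⟨x, v⟩).2 x = v := by
  rw [constField_apply hx]
  exact (tangentTriv I x₀).symm_apply_apply_mk hx v

lemma smoothAlongAt_constField {x₀ x : M} (hx : x ∈ (tangentTriv I x₀).baseSet) (c : E) :
    SmoothAlongAt I I id (constField I x₀ c) x := by
  refine ((tangentTriv I x₀).contMDiffAt_section_iff hx).2 ?_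
  refine (contMDiffAt_const (c := c)).congr_of_eventuallyEq ?_
  filter_upwards [(tangentTriv I x₀).open_baseSet.mem_nhds hx] with y hy
  exact tangentTriv_constField hy c

lemma diffFieldAt_constField {x₀ x : M} (hx : x ∈ (tangentTriv I x₀).baseSet) (c : E) :
    DiffFieldAt (constField I x₀ c) x :=
  (smoothAlongAt_constField hx c).mdifferentiableAt (by simp)

/-- The Levi-Civita connection of `g`. -/
abbrev connection (X Y : ∀ x : M, TangentSpace I x) (x : M) : TangentSpace I x :=
  leviCivita I (metricForm g) X Y x

variable [FiniteDimensional ℝ E]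

/-- A vector field is smooth if its inner products with constant fields are. -/
lemma smoothAlongAt_of_metricForm {W : ∀ x : M, TangentSpace I x} {x₀ : M}
    (hW : ∀ c : E, ContMDiffAt I 𝓘(ℝ, ℝ) ∞
      (fun x => metricForm g x (W x) (constField I x₀ c x)) x₀) :
    SmoothAlongAt I I id W x₀ := by
  have hx₀ : x₀ ∈ (tangentTriv I x₀).baseSet := FiberBundle.mem_baseSet_trivializationAt' x₀
  have : CompleteSpace E := FiniteDimensional.complete ℝ E
  -- In the frame of constant fields, A is the Gram operator of g, and θ below is the covector g(W,
  -- ·). The components of W are then A⁻¹θ.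
  let A : M → E →L[ℝ] E →L[ℝ] ℝ := fun x =>
    ContinuousLinearMap.inCoordinates E (TangentSpace I) (E →L[ℝ] ℝ)
      (fun x : M => TangentSpace I x →L[ℝ] ℝ) x₀ x x₀ x (g.inner x)
  have hA : ContMDiffAt I 𝓘(ℝ, E →L[ℝ] E →L[ℝ] ℝ) ∞ A x₀ :=
    ((contMDiffAt_hom_bundle _).1 (g.contMDiff.contMDiffAt (x := x₀))).2
  have hA' : ∀ x ∈ (tangentTriv I x₀).baseSet, ∀ c d,
      A x c d = metricForm g x (constField I x₀ c x) (constField I x₀ d x) := by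
    intro x hx c d
    rw [constField_apply hx, constField_apply hx]
    refine (inCoordinates_apply_eq₂ (𝕜 := ℝ) (F₁ := E) (F₂ := E) (F₃ := ℝ)
      (E₁ := fun x : M => TangentSpace I x) (E₂ := fun x : M => TangentSpace I x)
      (E₃ := Bundle.Trivial M ℝ) (ϕ := g.inner x) (v := c) (w := d) hx hx (mem_univ x)).trans ?_
    simp
  let b := Module.finBasis ℝ E
  let θ : M → E →L[ℝ] ℝ := fun x => ∑ i, metricForm g x (W x) (constField I x₀ (b i) x) •
    LinearMap.toContinuousLinearMap (b.coord i)
  have hθ : ContMDiffAt I 𝓘(ℝ, E →L[ℝ] ℝ) ∞ θ x₀ :=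
    contMDiffAt_finsetSum fun i _ => (hW (b i)).smul contMDiffAt_const
  have hθ' : ∀ x c, θ x c = metricForm g x (W x) (constField I x₀ c x) := by
    intro x c
    let φ : E →ₗ[ℝ] ℝ := (g.inner x (W x) ∘L (tangentTriv I x₀).symmL ℝ x : E →L[ℝ] ℝ)
    have h1 : φ c = ∑ i, b.coord i c * φ (b i) := by
      conv_lhs => rw [← b.sum_repr c, map_sum]
      exact Finset.sum_congr rfl fun i _ => by rw [map_smul]; rfl
    refine Eq.trans ?_ h1.symm
    simp only [θ, sum_apply, smul_apply, smul_eq_mul]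
    exact Finset.sum_congr rfl fun i _ => mul_comm _ _
  -- Positive definiteness gives injectivity, and E and its dual have the same dimension.
  have hAinv : ∀ x ∈ (tangentTriv I x₀).baseSet, (A x).IsInvertible := by
    intro x hx
    have hinj : Function.Injective (A x : E →ₗ[ℝ] E →L[ℝ] ℝ) := by
      refine (injective_iff_map_eq_zero _).2 fun c hc => ?_
      have h1 : metricForm g x (constField I x₀ c x) (constField I x₀ c x) = 0 := by
        rw [← hA' x hx]
        exact congrArg (fun L : E →L[ℝ] ℝ => L c) hc
      have h2 : constField I x₀ c x = 0 := by
        by_contra h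
        exact (g.pos x _ h).ne' h1
      have h3 : constField I x₀ (0 : E) x = 0 := map_zero ((tangentTriv I x₀).symmL ℝ x)
      rw [← tangentTriv_constField hx c, h2, ← h3, tangentTriv_constField hx]
    have hrank : Module.finrank ℝ E = Module.finrank ℝ (E →L[ℝ] ℝ) := by
      rw [← (LinearMap.toContinuousLinearMap (𝕜 := ℝ) (E := E) (F' := ℝ)).finrank_eq]
      exact Subspace.dual_finrank_eq.symm
    let L := LinearEquiv.ofInjectiveOfFinrankEq _ hinj hrank
    exact ⟨L.toContinuousLinearEquiv, by ext; rfl⟩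
  refine ((tangentTriv I x₀).contMDiffAt_section_iff hx₀).2 ?_
  -- Operator inversion is smooth at an invertible operator, so A⁻¹θ is smooth at x₀.
  have hmain : ContMDiffAt I 𝓘(ℝ, E) ∞ (fun x => (A x).inverse (θ x)) x₀ := by
    obtain ⟨L, hL⟩ := hAinv x₀ hx₀
    refine ContMDiffAt.clm_apply ?_ hθ
    have h1 : ContDiffAt ℝ ∞ ContinuousLinearMap.inverse (A x₀) := by
      rw [← hL]; exact contDiffAt_map_inverse L
    exact ContMDiffAt.comp x₀ h1.contMDiffAt hA
  refine hmain.congr_of_eventuallyEq ?_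
  filter_upwards [(tangentTriv I x₀).open_baseSet.mem_nhds hx₀] with x hx
  have h1 : θ x = A x (tangentTriv I x₀ ⟨x, W x⟩).2 := by
    ext d
    rw [hθ', hA' x hx, constField_tangentTriv hx]
  rw [h1]
  obtain ⟨L, hL⟩ := hAinv x hx
  rw [← hL]
  simp

end Riemannian

/-! ### Christoffel symbols and their smoothness. -/

section Connection

variable {E : Type*} [NormedAddCommGroup E] [NormedSpace ℝ E]
  {H : Type*} [TopologicalSpace H] {I : ModelWithCorners ℝ E H}
  {M : Type*} [TopologicalSpace M] [ChartedSpace H M] [IsManifold I ∞ M]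
  (g : ContMDiffRiemannianMetric I ∞ E (fun x : M => TangentSpace I x))

/-- The components of a tangent vector in the preferred chart at `x₀`. -/
abbrev fibreCoord (I : ModelWithCorners ℝ E H) [IsManifold I ∞ M] (x₀ x : M) :
    TangentSpace I x →L[ℝ] E :=
  (tangentTriv I x₀).continuousLinearMapAt ℝ x

lemma fibreCoord_apply {x₀ x : M} (hx : x ∈ (tangentTriv I x₀).baseSet) (v : TangentSpace I x) :
    fibreCoord I x₀ x v = (tangentTriv I x₀ ⟨x, v⟩).2 :=
  congrFun ((tangentTriv I x₀).coe_linearMapAt_of_mem hx) v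

lemma fibreCoord_constField {x₀ x : M} (hx : x ∈ (tangentTriv I x₀).baseSet) (c : E) :
    fibreCoord I x₀ x (constField I x₀ c x) = c := by
  rw [fibreCoord_apply hx, tangentTriv_constField hx]

lemma constField_fibreCoord {x₀ x : M} (hx : x ∈ (tangentTriv I x₀).baseSet)
    (v : TangentSpace I x) : constField I x₀ (fibreCoord I x₀ x v) x = v := by
  rw [fibreCoord_apply hx, constField_tangentTriv hx]

/-- The derivative at `x` along `v` of the components of the vector field `Y`. -/
def fieldDeriv (x₀ : M) (Y : ∀ x : M, TangentSpace I x) (x : M) (v : TangentSpace I x) : E :=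
  mfderiv I 𝓘(ℝ, E) (fun q => fibreCoord I x₀ q (Y q)) x v

lemma mdifferentiableAt_fibreCoord {x₀ x : M} (hx : x ∈ (tangentTriv I x₀).baseSet)
    {Y : ∀ x : M, TangentSpace I x} (hY : DiffFieldAt Y x) :
    MDifferentiableAt I 𝓘(ℝ, E) (fun q => fibreCoord I x₀ q (Y q)) x := by
  refine (((tangentTriv I x₀).mdifferentiableAt_section_iff I Y hx).1 hY).congr_of_eventuallyEq ?_
  filter_upwards [(tangentTriv I x₀).open_baseSet.mem_nhds hx] with y hy
  exact fibreCoord_apply hy _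

lemma fieldDeriv_add {x₀ x : M} (hx : x ∈ (tangentTriv I x₀).baseSet)
    {Y Y' : ∀ x : M, TangentSpace I x} (hY : DiffFieldAt Y x) (hY' : DiffFieldAt Y' x)
    (v : TangentSpace I x) :
    fieldDeriv x₀ (Y + Y') x v = fieldDeriv x₀ Y x v + fieldDeriv x₀ Y' x v := by
  have h1 : (fun q => fibreCoord I x₀ q ((Y + Y') q))
      = (fun q => fibreCoord I x₀ q (Y q)) + fun q => fibreCoord I x₀ q (Y' q) :=
    funext fun q => map_add (fibreCoord I x₀ q) (Y q) (Y' q)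
  rw [fieldDeriv, h1]
  exact congrArg (fun L => L v) (mvfderiv_add (mdifferentiableAt_fibreCoord hx hY)
    (mdifferentiableAt_fibreCoord hx hY'))

lemma fieldDeriv_smul {x₀ x : M} (hx : x ∈ (tangentTriv I x₀).baseSet)
    {Y : ∀ x : M, TangentSpace I x} {f : M → ℝ} (hf : MDifferentiableAt I 𝓘(ℝ, ℝ) f x)
    (hY : DiffFieldAt Y x) (v : TangentSpace I x) :
    fieldDeriv x₀ (f • Y) x v
      = f x • fieldDeriv x₀ Y x v + dirDeriv I f x v • fibreCoord I x₀ x (Y x) := by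
  have h1 : (fun q => fibreCoord I x₀ q ((f • Y) q))
      = f • fun q => fibreCoord I x₀ q (Y q) :=
    funext fun q => map_smul (fibreCoord I x₀ q) (f q) (Y q)
  rw [fieldDeriv, h1]
  exact congrArg (fun L => L v) (mvfderiv_smul hf (mdifferentiableAt_fibreCoord hx hY))

lemma fieldDeriv_constField {x₀ x : M} (hx : x ∈ (tangentTriv I x₀).baseSet) (c : E)
    (v : TangentSpace I x) : fieldDeriv x₀ (constField I x₀ c) x v = 0 := by
  have h1 : (fun q => fibreCoord I x₀ q (constField I x₀ c q)) =ᶠ[𝓝 x] fun _ => c := by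
    filter_upwards [(tangentTriv I x₀).open_baseSet.mem_nhds hx] with y hy
    exact fibreCoord_constField hy c
  rw [fieldDeriv, h1.mfderiv_eq, mfderiv_const]
  rfl

variable [FiniteDimensional ℝ E]

/-- The Levi-Civita connection in the preferred chart at `x₀`: the derivative of the components plus
a term depending only on the values of the fields. -/
lemma connection_eq {x₀ x : M} (hx : x ∈ (tangentTriv I x₀).baseSet)
    {X Y : ∀ x : M, TangentSpace I x} (hX : DiffFieldAt X x) (hY : DiffFieldAt Y x) :
    connection g X Y x = constField I x₀ (fieldDeriv x₀ Y x (X x)) x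
      + connection g (constField I x₀ (fibreCoord I x₀ x (X x)))
          (constField I x₀ (fibreCoord I x₀ x (Y x))) x := by
  have : CompleteSpace E := FiniteDimensional.complete ℝ E
  have hg := isMetric_metricForm g
  refine hg.ext fun w => ?_
  have hZ : DiffFieldAt (FiberBundle.extend E w) x := FiberBundle.mdifferentiableAt_extend ..
  have hZx : FiberBundle.extend E w x = w := by simp
  have hc (c : E) : DiffFieldAt (constField I x₀ c) x := diffFieldAt_constField hx c
  -- The Leibniz term of ∇_X Y equals that of the derivative of the components, so the difference
  -- depends only on the value of Y at x. Hence Y may be replaced by the constant field with that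
  -- value, whose components have zero derivative; X is replaced afterwards, the Koszul expression
  -- being tensorial in it.
  have hT : TensorialAt I E (fun Y : ∀ x : M, TangentSpace I x =>
      koszul I (metricForm g) X Y (FiberBundle.extend E w) x
        - 2 * metricForm g x (constField I x₀ (fieldDeriv x₀ Y x (X x)) x) w) x := by
    constructor
    · intro f σ hf hσ
      rw [hg.koszul_smul_middle hf hX hσ hZ, fieldDeriv_smul hx hf hσ, constField_add,
        constField_smul, constField_smul, Pi.add_apply, Pi.smul_apply, Pi.smul_apply,
        constField_fibreCoord hx, hg.add_left, hg.smul_left, hg.smul_left, hZx, smul_eq_mul]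
      ring
    · intro σ σ' hσ hσ'
      rw [hg.koszul_add_middle hX hσ hσ' hZ, fieldDeriv_add hx hσ hσ', constField_add,
        Pi.add_apply, hg.add_left]
      ring
  have h1 := hT.pointwise hY (hc (fibreCoord I x₀ x (Y x))) (constField_fibreCoord hx _).symm
  have h0 : constField I x₀ (0 : E) x = 0 := map_zero ((tangentTriv I x₀).symmL ℝ x)
  have h00 : metricForm g x 0 w = 0 := by simpa using hg.smul_left x 0 0 w
  have h2 := (hg.tensorialAt_koszul_left (hc (fibreCoord I x₀ x (Y x))) hZ).pointwise hX
    (hc (fibreCoord I x₀ x (X x))) (constField_fibreCoord hx _).symm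
  have h3 := hg.two_mul_leviCivita hX hY hZ
  have h4 := hg.two_mul_leviCivita (hc (fibreCoord I x₀ x (X x)))
    (hc (fibreCoord I x₀ x (Y x))) hZ
  rw [fieldDeriv_constField hx, h0, h00] at h1
  rw [hZx] at h3 h4
  rw [hg.add_left]
  linarith

/-- The Christoffel symbols, as a bilinear map. -/
def christoffel {x₀ x : M} (hx : x ∈ (tangentTriv I x₀).baseSet) : E →ₗ[ℝ] E →ₗ[ℝ] E :=
  have : CompleteSpace E := FiniteDimensional.complete ℝ E
  have hg := isMetric_metricForm g
  have hd (c : E) : DiffFieldAt (constField I x₀ c) x := diffFieldAt_constField hx c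
  have key (c d : E) (w : TangentSpace I x) := hg.two_mul_leviCivita (hd c) (hd d)
    (Z := FiberBundle.extend E w) (FiberBundle.mdifferentiableAt_extend ..)
  LinearMap.mk₂ ℝ (fun c d => fibreCoord I x₀ x
      (connection g (constField I x₀ c) (constField I x₀ d) x))
    (fun c c' d => by
      rw [← map_add]
      congr 1
      refine hg.ext fun w => ?_
      have h1 := key c d w
      have h2 := key c' d w
      have h3 := key (c + c') d w
      rw [constField_add, hg.koszul_add_left (hd c) (hd c') (hd d)
        (FiberBundle.mdifferentiableAt_extend ..)] at h3
      simp only [FiberBundle.extend_apply_self] at h1 h2 h3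
      rw [hg.add_left, constField_add]
      linarith)
    (fun r c d => by
      rw [← map_smul]
      congr 1
      refine hg.ext fun w => ?_
      have h1 := key c d w
      have h3 := key (r • c) d w
      have h4 := hg.koszul_smul_left (f := fun _ => r) mdifferentiableAt_const (hd c) (hd d)
        (Z := FiberBundle.extend E w) (FiberBundle.mdifferentiableAt_extend ..)
      rw [constField_smul, show r • constField I x₀ c = (fun _ : M => r) • constField I x₀ c from rfl,
        h4] at h3
      simp only [FiberBundle.extend_apply_self] at h1 h3
      rw [hg.smul_left, constField_smul,
        show r • constField I x₀ c = (fun _ : M => r) • constField I x₀ c from rfl]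
      linear_combination h3 / 2 - r * h1 / 2)
    (fun c d d' => by
      rw [← map_add]
      congr 1
      refine hg.ext fun w => ?_
      have h1 := key c d w
      have h2 := key c d' w
      have h3 := key c (d + d') w
      rw [constField_add, hg.koszul_add_middle (hd c) (hd d) (hd d')
        (FiberBundle.mdifferentiableAt_extend ..)] at h3
      simp only [FiberBundle.extend_apply_self] at h1 h2 h3
      rw [hg.add_left, constField_add]
      linarith)
    (fun r c d => by
      rw [← map_smul]
      congr 1
      refine hg.ext fun w => ?_
      have h1 := key c d w
      have h3 := key c (r • d) w
      have h4 := hg.koszul_smul_middle (f := fun _ => r) mdifferentiableAt_const (hd c) (hd d)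
        (Z := FiberBundle.extend E w) (FiberBundle.mdifferentiableAt_extend ..)
      have h5 : dirDeriv I (fun _ : M => r) x (constField I x₀ c x) = 0 := by
        rw [dirDeriv, mfderiv_const]; rfl
      rw [constField_smul, show r • constField I x₀ d = (fun _ : M => r) • constField I x₀ d from rfl,
        h4, h5] at h3
      simp only [FiberBundle.extend_apply_self] at h1 h3
      rw [hg.smul_left, constField_smul,
        show r • constField I x₀ d = (fun _ : M => r) • constField I x₀ d from rfl]
      linear_combination h3 / 2 - r * h1 / 2)

lemma christoffel_apply {x₀ x : M} (hx : x ∈ (tangentTriv I x₀).baseSet) (c d : E) :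
    christoffel g hx c d
      = fibreCoord I x₀ x (connection g (constField I x₀ c) (constField I x₀ d) x) := rfl

/-- The components of the covariant derivatives of constant fields are smooth. -/
lemma smoothAlongAt_connection_constField (x₀ : M) (c d : E) :
    SmoothAlongAt I I id
      (fun x => connection g (constField I x₀ c) (constField I x₀ d) x) x₀ := by
  have : CompleteSpace E := FiniteDimensional.complete ℝ E
  have hx₀ : x₀ ∈ (tangentTriv I x₀).baseSet := FiberBundle.mem_baseSet_trivializationAt' x₀
  -- The inner product with a constant field is half a Koszul expression of smooth fields near x₀.
  refine smoothAlongAt_of_metricForm g fun c' => ?_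
  have h1 := (isSmoothForm_metricForm g).contMDiffAt_koszul (smoothAlongAt_constField hx₀ c)
    (smoothAlongAt_constField hx₀ d) (smoothAlongAt_constField hx₀ c')
  have h2 := contMDiffAt_const (c := (1 / 2 : ℝ)) (I := I) (x := x₀) (I' := 𝓘(ℝ, ℝ)) (n := ∞)
  refine (h2.mul h1).congr_of_eventuallyEq ?_
  filter_upwards [(tangentTriv I x₀).open_baseSet.mem_nhds hx₀] with x hx
  have := (isMetric_metricForm g).two_mul_leviCivita (diffFieldAt_constField hx c)
    (diffFieldAt_constField hx d) (diffFieldAt_constField hx c')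
  rw [Pi.mul_apply, ← this]
  ring

end Connection

/-! ### The coordinates (x, y) on TM and their differentials. -/

section TangentGeometry

variable {E : Type*} [NormedAddCommGroup E] [NormedSpace ℝ E]
  {H : Type*} [TopologicalSpace H] {I : ModelWithCorners ℝ E H}
  {M : Type*} [TopologicalSpace M] [ChartedSpace H M] [IsManifold I ∞ M]

instance isManifold_tangentBundle : IsManifold I.tangent ∞ (TangentBundle I M) := by
  have : ContMDiffVectorBundle ∞ E (TangentSpace I : M → Type _) I :=
    TangentBundle.contMDiffVectorBundle (h := inferInstanceAs (IsManifold I ∞ M))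
  exact Bundle.TotalSpace.isManifold E (TangentSpace I)

/-- The fibre coordinates on the tangent bundle in the preferred chart at `x₀`. -/
def yCoord (I : ModelWithCorners ℝ E H) [IsManifold I ∞ M] (x₀ : M) (q : TangentBundle I M) : E :=
  (tangentTriv I x₀ q).2

lemma contMDiffAt_yCoord {x₀ : M} {p : TangentBundle I M}
    (hp : p.proj ∈ (tangentTriv I x₀).baseSet) :
    ContMDiffAt I.tangent 𝓘(ℝ, E) ∞ (yCoord I x₀) p := by
  have : ContMDiffVectorBundle ∞ E (TangentSpace I : M → Type _) I :=
    TangentBundle.contMDiffVectorBundle (h := inferInstanceAs (IsManifold I ∞ M))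
  have h := ((tangentTriv I x₀).contMDiffAt_iff (IM := I.tangent) (IB := I) (n := ∞)
    (f := fun q : TangentBundle I M => q) (x₀ := p) ((tangentTriv I x₀).mem_source.2 hp)).1
    contMDiffAt_id
  exact h.2

lemma contMDiff_tangentBundle_proj :
    ContMDiff I.tangent I ∞ (fun q : TangentBundle I M => q.proj) :=
  contMDiff_proj (TangentSpace I)

lemma mdifferentiableAt_yCoord {x₀ : M} {p : TangentBundle I M}
    (hp : p.proj ∈ (tangentTriv I x₀).baseSet) :
    MDifferentiableAt I.tangent 𝓘(ℝ, E) (yCoord I x₀) p :=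
  (contMDiffAt_yCoord hp).mdifferentiableAt (by simp)

lemma mdifferentiableAt_tangentBundle_proj (p : TangentBundle I M) :
    MDifferentiableAt I.tangent I (fun q : TangentBundle I M => q.proj) p :=
  contMDiff_tangentBundle_proj.mdifferentiableAt (by simp)

/-- The differential of the fibre coordinates. -/
def dyCoord (x₀ : M) (p : TangentBundle I M) : TangentSpace I.tangent p →L[ℝ] E :=
  mfderiv I.tangent 𝓘(ℝ, E) (yCoord I x₀) p

/-- The inclusion of the tangent space at `x` into the tangent bundle. -/
def fiberIncl (I : ModelWithCorners ℝ E H) (x : M) (w : E) : TangentBundle I M := ⟨x, w⟩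

/-- The fibre coordinates at `x`, on the model space. -/
def fibreCoordModel (I : ModelWithCorners ℝ E H) [IsManifold I ∞ M] (x₀ x : M) : E →L[ℝ] E :=
  fibreCoord I x₀ x

lemma yCoord_comp_fiberIncl {x₀ x : M} (hx : x ∈ (tangentTriv I x₀).baseSet) :
    yCoord I x₀ ∘ fiberIncl I x = fibreCoordModel I x₀ x :=
  funext fun w => (fibreCoord_apply hx w).symm

lemma contMDiff_fiberIncl (x : M) : ContMDiff 𝓘(ℝ, E) I.tangent ∞ (fiberIncl I x) := by
  have hx : x ∈ (tangentTriv I x).baseSet := FiberBundle.mem_baseSet_trivializationAt' x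
  refine fun w => contMDiffAt_totalSpace.2 ⟨contMDiffAt_const, ?_⟩
  change ContMDiffAt _ _ _ (yCoord I x ∘ fiberIncl I x) w
  rw [yCoord_comp_fiberIncl hx]
  exact (fibreCoordModel I x x).contMDiff.contMDiffAt

lemma mdifferentiableAt_fiberIncl (x : M) (w : E) :
    MDifferentiableAt 𝓘(ℝ, E) I.tangent (fiberIncl I x) w :=
  (contMDiff_fiberIncl x).mdifferentiableAt (by simp)

lemma dproj_mfderiv_fiberIncl (x : M) (y w : E) :
    dproj (fiberIncl I x y) (mfderiv 𝓘(ℝ, E) I.tangent (fiberIncl I x) y w) = 0 := by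
  have h1 := mfderiv_comp y (mdifferentiableAt_tangentBundle_proj (fiberIncl I x y))
    (mdifferentiableAt_fiberIncl x y)
  have h2 : (fun q : TangentBundle I M => q.proj) ∘ fiberIncl I x = fun _ => x := rfl
  rw [h2, mfderiv_const] at h1
  exact (congrArg (fun L : E →L[ℝ] E => L w) h1).symm

lemma dproj_verticalLift (p : TangentBundle I M) (v : TangentSpace I p.proj) :
    dproj p (verticalLift p v) = 0 :=
  dproj_mfderiv_fiberIncl (E := E) (I := I) p.proj p.snd v

lemma dyCoord_mfderiv_fiberIncl {x₀ x : M} (hx : x ∈ (tangentTriv I x₀).baseSet) (y w : E) :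
    dyCoord x₀ (fiberIncl I x y) (mfderiv 𝓘(ℝ, E) I.tangent (fiberIncl I x) y w)
      = fibreCoordModel I x₀ x w := by
  have h1 := mfderiv_comp y (mdifferentiableAt_yCoord (p := fiberIncl I x y) hx)
    (mdifferentiableAt_fiberIncl x y)
  rw [yCoord_comp_fiberIncl hx, ContinuousLinearMap.mfderiv_eq] at h1
  exact (congrArg (fun L : E →L[ℝ] E => L w) h1).symm

lemma dyCoord_verticalLift {x₀ : M} {p : TangentBundle I M}
    (hp : p.proj ∈ (tangentTriv I x₀).baseSet) (v : TangentSpace I p.proj) :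
    dyCoord x₀ p (verticalLift p v) = fibreCoord I x₀ p.proj v :=
  dyCoord_mfderiv_fiberIncl (E := E) (I := I) hp p.snd v

/-- A section followed by the projection is the identity. The vector y is kept separate from Y x
because the base point of `sectionDeriv` agrees with the value of its section only propositionally;
the equation is removed by substitution. -/
lemma dproj_mfderiv_section {x : M} {Y : ∀ x : M, TangentSpace I x} (hY : DiffFieldAt Y x)
    {y : TangentSpace I x} (hy : Y x = y) (v : TangentSpace I x) :
    dproj (⟨x, y⟩ : TangentBundle I M)
      (mfderiv I I.tangent (fun q => (⟨q, Y q⟩ : TangentBundle I M)) x v :) = v := by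
  subst hy
  have h1 := mfderiv_comp x (mdifferentiableAt_tangentBundle_proj (⟨x, Y x⟩ : TangentBundle I M)) hY
  have h2 : (fun q : TangentBundle I M => q.proj) ∘ (fun q => (⟨q, Y q⟩ : TangentBundle I M)) = id :=
    rfl
  rw [h2, mfderiv_id] at h1
  exact (congrArg (fun L => L v) h1).symm

lemma dyCoord_mfderiv_section {x₀ x : M} (hx : x ∈ (tangentTriv I x₀).baseSet)
    {Y : ∀ x : M, TangentSpace I x} (hY : DiffFieldAt Y x)
    {y : TangentSpace I x} (hy : Y x = y) (v : TangentSpace I x) :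
    dyCoord x₀ (⟨x, y⟩ : TangentBundle I M)
      (mfderiv I I.tangent (fun q => (⟨q, Y q⟩ : TangentBundle I M)) x v :)
      = fieldDeriv x₀ Y x v := by
  subst hy
  have h1 := mfderiv_comp x
    (mdifferentiableAt_yCoord (p := (⟨x, Y x⟩ : TangentBundle I M)) hx) hY
  have h2 : yCoord I x₀ ∘ (fun q => (⟨q, Y q⟩ : TangentBundle I M))
      =ᶠ[𝓝 x] fun q => fibreCoord I x₀ q (Y q) := by
    filter_upwards [(tangentTriv I x₀).open_baseSet.mem_nhds hx] with q hq
    exact (fibreCoord_apply hq _).symm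
  rw [h2.mfderiv_eq] at h1
  exact (congrArg (fun L => L v) h1).symm

/-- The derivative of the preferred chart of `TM`. -/
lemma mfderiv_extChartAt_tangentBundle (p₀ p : TangentBundle I M)
    (hp : p.proj ∈ (tangentTriv I p₀.proj).baseSet) (ξ : TangentSpace I.tangent p) :
    (mfderiv I.tangent 𝓘(ℝ, E × E) (extChartAt I.tangent p₀) p ξ : E × E)
      = (fibreCoord I p₀.proj p.proj (dproj p ξ), dyCoord p₀.proj p ξ) := by
  have hF : MDifferentiableAt I.tangent 𝓘(ℝ, E × E) (extChartAt I.tangent p₀) p :=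
    mdifferentiableAt_extChartAt ((TangentBundle.mem_chart_source_iff p p₀).2 hp)
  have heq : (extChartAt I.tangent p₀ : TangentBundle I M → E × E)
      = fun q => (extChartAt I p₀.proj q.proj, yCoord I p₀.proj q) := by
    rw [FiberBundle.extChartAt (IB := I) p₀]
    funext q
    rfl
  have hp' : p.proj ∈ (chartAt H p₀.proj).source := hp
  refine Prod.ext ?_ ?_
  · have h1 := mfderiv_comp p
      (ContinuousLinearMap.mdifferentiableAt (ContinuousLinearMap.fst ℝ E E)) hF
    have h2 := mfderiv_comp p (mdifferentiableAt_extChartAt (I := I) (x := p₀.proj) hp')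
      (mdifferentiableAt_tangentBundle_proj p)
    have h3 : (ContinuousLinearMap.fst ℝ E E) ∘ (extChartAt I.tangent p₀ : TangentBundle I M → E × E)
      = (extChartAt I p₀.proj) ∘ (fun q : TangentBundle I M => q.proj) := by rw [heq]; rfl
    rw [h3, ContinuousLinearMap.mfderiv_eq, h2,
      ← TangentBundle.continuousLinearMapAt_trivializationAt hp'] at h1
    exact (congrArg (fun L => L ξ) h1).symm
  · have h1 := mfderiv_comp p
      (ContinuousLinearMap.mdifferentiableAt (ContinuousLinearMap.snd ℝ E E)) hF
    have h3 : (ContinuousLinearMap.snd ℝ E E) ∘ (extChartAt I.tangent p₀ : TangentBundle I M → E × E)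
      = yCoord I p₀.proj := by rw [heq]; rfl
    rw [h3, ContinuousLinearMap.mfderiv_eq] at h1
    exact (congrArg (fun L => L ξ) h1).symm

end TangentGeometry

/-! ### The horizontal and vertical splitting of TTM. -/

section Splitting

variable {E : Type*} [NormedAddCommGroup E] [NormedSpace ℝ E]
  {H : Type*} [TopologicalSpace H] {I : ModelWithCorners ℝ E H}
  {M : Type*} [TopologicalSpace M] [ChartedSpace H M] [IsManifold I ∞ M]

lemma dproj_add (p : TangentBundle I M) (ξ η : TangentSpace I.tangent p) :
    dproj p (ξ + η) = dproj p ξ + dproj p η :=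
  map_add (mfderiv I.tangent I (fun q : TangentBundle I M => q.proj) p) ξ η

lemma dproj_smul (p : TangentBundle I M) (r : ℝ) (ξ : TangentSpace I.tangent p) :
    dproj p (r • ξ) = r • dproj p ξ :=
  map_smul (mfderiv I.tangent I (fun q : TangentBundle I M => q.proj) p) r ξ

lemma dproj_sub (p : TangentBundle I M) (ξ η : TangentSpace I.tangent p) :
    dproj p (ξ - η) = dproj p ξ - dproj p η :=
  map_sub (mfderiv I.tangent I (fun q : TangentBundle I M => q.proj) p) ξ η

lemma mem_baseSet_tangentTriv (x : M) : x ∈ (tangentTriv I x).baseSet :=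
  FiberBundle.mem_baseSet_trivializationAt' x

lemma fibreCoord_injective {x₀ x : M} (hx : x ∈ (tangentTriv I x₀).baseSet)
    {v w : TangentSpace I x} (h : fibreCoord I x₀ x v = fibreCoord I x₀ x w) : v = w := by
  rw [← constField_fibreCoord hx v, h, constField_fibreCoord hx]

lemma dproj_sectionDeriv {p : TangentBundle I M} (v : TangentSpace I p.proj) :
    dproj p (sectionDeriv p v) = v :=
  dproj_mfderiv_section (FiberBundle.mdifferentiableAt_extend ..)
    (FiberBundle.extend_apply_self E p.snd) v

lemma dyCoord_sectionDeriv {x₀ : M} {p : TangentBundle I M}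
    (hp : p.proj ∈ (tangentTriv I x₀).baseSet) (v : TangentSpace I p.proj) :
    dyCoord x₀ p (sectionDeriv p v) = fieldDeriv x₀ (FiberBundle.extend E p.snd) p.proj v :=
  dyCoord_mfderiv_section hp (FiberBundle.mdifferentiableAt_extend ..)
    (FiberBundle.extend_apply_self E p.snd) v

lemma dproj_horizontalLift
    (g : ContMDiffRiemannianMetric I ∞ E (fun x : M => TangentSpace I x))
    {p : TangentBundle I M} (v : TangentSpace I p.proj) :
    dproj p (horizontalLift g p v) = v := by
  rw [horizontalLift, dproj_sub, dproj_sectionDeriv, dproj_verticalLift, sub_zero]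

variable (g : ContMDiffRiemannianMetric I ∞ E (fun x : M => TangentSpace I x))
  [FiniteDimensional ℝ E]

/-- The components of the vertical part of a tangent vector to `TM`. -/
def connCoord {x₀ : M} {p : TangentBundle I M} (hp : p.proj ∈ (tangentTriv I x₀).baseSet)
    (ξ : TangentSpace I.tangent p) : E :=
  dyCoord x₀ p ξ + christoffel g hp (fibreCoord I x₀ p.proj (dproj p ξ)) (yCoord I x₀ p)

variable {x₀ : M} {p : TangentBundle I M} (hp : p.proj ∈ (tangentTriv I x₀).baseSet)

lemma connCoord_add (ξ η : TangentSpace I.tangent p) :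
    connCoord g hp (ξ + η) = connCoord g hp ξ + connCoord g hp η := by
  simp only [connCoord, dproj_add]
  rw [map_add, map_add, map_add, LinearMap.add_apply]
  abel

lemma connCoord_smul (r : ℝ) (ξ : TangentSpace I.tangent p) :
    connCoord g hp (r • ξ) = r • connCoord g hp ξ := by
  simp only [connCoord, dproj_smul]
  rw [map_smul, map_smul, map_smul, LinearMap.smul_apply, smul_add]

lemma connCoord_sub (ξ η : TangentSpace I.tangent p) :
    connCoord g hp (ξ - η) = connCoord g hp ξ - connCoord g hp η := by
  simp only [connCoord, dproj_sub]
  rw [map_sub, map_sub, map_sub, LinearMap.sub_apply]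
  abel

lemma connCoord_verticalLift (v : TangentSpace I p.proj) :
    connCoord g hp (verticalLift p v) = fibreCoord I x₀ p.proj v := by
  rw [connCoord, dyCoord_verticalLift hp, dproj_verticalLift, map_zero, map_zero,
    LinearMap.zero_apply, add_zero]

/-- By `connection_eq`, the derivative of the components of Y along v plus Γ(v, y) is precisely ∇_v
Y. Thus `connCoord` kills horizontal lifts. -/
lemma connCoord_sectionDeriv (v : TangentSpace I p.proj) :
    connCoord g hp (sectionDeriv p v) = fibreCoord I x₀ p.proj
      (connection g (FiberBundle.extend E v) (FiberBundle.extend E p.snd) p.proj) := by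
  rw [connection_eq g hp (FiberBundle.mdifferentiableAt_extend ..)
    (FiberBundle.mdifferentiableAt_extend ..), map_add, fibreCoord_constField hp, connCoord,
    dyCoord_sectionDeriv hp, dproj_sectionDeriv, christoffel_apply, FiberBundle.extend_apply_self,
    FiberBundle.extend_apply_self, fibreCoord_apply hp p.snd]
  rfl

lemma connCoord_horizontalLift (v : TangentSpace I p.proj) :
    connCoord g hp (horizontalLift g p v) = 0 := by
  rw [horizontalLift, connCoord_sub, connCoord_sectionDeriv, connCoord_verticalLift, sub_self]

/-- The coordinate `connCoord` differs from `dyCoord` by a term depending on ξ only through `dproj`,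
and the pair of `dproj` and `dyCoord` is the invertible differential of a chart of TM. -/
lemma eq_of_dproj_of_connCoord {ξ η : TangentSpace I.tangent p} (h₁ : dproj p ξ = dproj p η)
    (h₂ : connCoord g hp ξ = connCoord g hp η) : ξ = η := by
  have h₃ : dyCoord x₀ p ξ = dyCoord x₀ p η := by
    simpa [connCoord, h₁] using h₂
  -- The preferred chart of TM at a point depends only on its base point, so the zero vector over x₀
  -- serves.
  have hinv := isInvertible_mfderiv_extChartAt (I := I.tangent) (x := (⟨x₀, 0⟩ : TangentBundle I M))
    (y := p) (by
      rw [extChartAt_source]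
      exact (TangentBundle.mem_chart_source_iff _ _).2 hp)
  obtain ⟨L, hL⟩ := hinv
  refine L.injective ?_
  have h₄ := mfderiv_extChartAt_tangentBundle (⟨x₀, 0⟩ : TangentBundle I M) p hp ξ
  have h₅ := mfderiv_extChartAt_tangentBundle (⟨x₀, 0⟩ : TangentBundle I M) p hp η
  rw [h₁, h₃, ← h₅, ← hL] at h₄
  exact h₄

lemma eq_verticalLift_add_horizontalLift_iff (ξ : TangentSpace I.tangent p)
    (w : TangentSpace I p.proj) :
    ξ = verticalLift p w + horizontalLift g p (dproj p ξ)
      ↔ fibreCoord I x₀ p.proj w = connCoord g hp ξ := by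
  constructor
  · intro h
    rw [h, connCoord_add, connCoord_verticalLift, connCoord_horizontalLift, add_zero]
  · intro h
    refine eq_of_dproj_of_connCoord g hp ?_ ?_
    · rw [dproj_add, dproj_verticalLift,
    dproj_horizontalLift, zero_add]
    · rw [connCoord_add, connCoord_verticalLift, connCoord_horizontalLift, add_zero, h]

/-- The vector with components `connCoord` gives a decomposition of ξ, so the choice defining
`connector` is a genuine one, and the preceding equivalence determines it. -/
lemma fibreCoord_connector (ξ : TangentSpace I.tangent p) :
    fibreCoord I x₀ p.proj (connector g p ξ) = connCoord g hp ξ := by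
  refine (eq_verticalLift_add_horizontalLift_iff g hp ξ _).1 ?_
  have hex : ∃ w, ξ = verticalLift p w + horizontalLift g p (dproj p ξ) :=
    ⟨constField I x₀ (connCoord g hp ξ) p.proj,
      (eq_verticalLift_add_horizontalLift_iff g hp ξ _).2 (fibreCoord_constField hp _)⟩
  exact Classical.epsilon_spec hex

variable (p)

lemma connector_add (ξ η : TangentSpace I.tangent p) :
    connector g p (ξ + η) = connector g p ξ + connector g p η := by
  have hp := mem_baseSet_tangentTriv (I := I) p.proj
  refine fibreCoord_injective hp ?_
  rw [map_add, fibreCoord_connector g hp, fibreCoord_connector g hp, fibreCoord_connector g hp,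
    connCoord_add]

lemma connector_smul (r : ℝ) (ξ : TangentSpace I.tangent p) :
    connector g p (r • ξ) = r • connector g p ξ := by
  have hp := mem_baseSet_tangentTriv (I := I) p.proj
  refine fibreCoord_injective hp ?_
  rw [map_smul, fibreCoord_connector g hp, fibreCoord_connector g hp, connCoord_smul]

lemma connector_verticalLift (v : TangentSpace I p.proj) :
    connector g p (verticalLift p v) = v := by
  have hp := mem_baseSet_tangentTriv (I := I) p.proj
  exact fibreCoord_injective hp (by rw [fibreCoord_connector g hp, connCoord_verticalLift])

lemma connector_horizontalLift (v : TangentSpace I p.proj) :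
    connector g p (horizontalLift g p v) = 0 := by
  have hp := mem_baseSet_tangentTriv (I := I) p.proj
  exact fibreCoord_injective hp
    (by rw [fibreCoord_connector g hp, connCoord_horizontalLift, map_zero])

variable {p}

end Splitting

/-! ### Smooth fields on TM through their two parts. -/

section SmoothSplitting

variable {E : Type*} [NormedAddCommGroup E] [NormedSpace ℝ E]
  {H : Type*} [TopologicalSpace H] {I : ModelWithCorners ℝ E H}
  {M : Type*} [TopologicalSpace M] [ChartedSpace H M] [IsManifold I ∞ M]
  {EM : Type*} [NormedAddCommGroup EM] [NormedSpace ℝ EM]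
  {HM : Type*} [TopologicalSpace HM] {IM : ModelWithCorners ℝ EM HM}
  {P : Type*} [TopologicalSpace P] [ChartedSpace HM P]

lemma smoothAlongAt_iff {b : P → M} {v : ∀ m : P, TangentSpace I (b m)} {m : P}
    (hb : ContMDiffAt IM I ∞ b m) :
    SmoothAlongAt I IM b v m ↔
      ContMDiffAt IM 𝓘(ℝ, E) ∞ (fun m' => fibreCoord I (b m) (b m') (v m')) m := by
  rw [SmoothAlongAt, contMDiffAt_totalSpace]
  have hev : (fun m' => fibreCoord I (b m) (b m') (v m')) =ᶠ[𝓝 m]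
      fun m' => (tangentTriv I (b m) ⟨b m', v m'⟩).2 := by
    filter_upwards [hb.continuousAt.preimage_mem_nhds
      ((tangentTriv I (b m)).open_baseSet.mem_nhds (mem_baseSet_tangentTriv (b m)))] with m' hm'
    exact fibreCoord_apply hm' _
  exact ⟨fun h => h.2.congr_of_eventuallyEq hev, fun h => ⟨hb, h.congr_of_eventuallyEq hev.symm⟩⟩

lemma smoothAlongAt_add {b : P → M} {v w : ∀ m : P, TangentSpace I (b m)} {m : P}
    (hv : SmoothAlongAt I IM b v m) (hw : SmoothAlongAt I IM b w m) :
    SmoothAlongAt I IM b (fun m => v m + w m) m := by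
  have hb : ContMDiffAt IM I ∞ b m := (contMDiffAt_totalSpace.1 hv).1
  rw [smoothAlongAt_iff hb] at hv hw ⊢
  simp only [map_add]
  exact hv.add hw

lemma smoothAlongAt_smul {b : P → M} {f : P → ℝ} {v : ∀ m : P, TangentSpace I (b m)} {m : P}
    (hf : ContMDiffAt IM 𝓘(ℝ, ℝ) ∞ f m) (hv : SmoothAlongAt I IM b v m) :
    SmoothAlongAt I IM b (fun m => f m • v m) m := by
  have hb : ContMDiffAt IM I ∞ b m := (contMDiffAt_totalSpace.1 hv).1
  rw [smoothAlongAt_iff hb] at hv ⊢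
  simp only [map_smul]
  exact hf.smul hv

variable (g : ContMDiffRiemannianMetric I ∞ E (fun x : M => TangentSpace I x))
  [FiniteDimensional ℝ E]

/-- By bilinearity, Γ(c, d) is a finite sum of coordinates of c and d times covariant derivatives of
constant basis fields, whose components are smooth on M. -/
lemma contMDiffAt_christoffel_term {c d : TangentBundle I M → E} {p : TangentBundle I M}
    (hc : ContMDiffAt I.tangent 𝓘(ℝ, E) ∞ c p) (hd : ContMDiffAt I.tangent 𝓘(ℝ, E) ∞ d p) :
    ContMDiffAt I.tangent 𝓘(ℝ, E) ∞ (fun q => fibreCoord I p.proj q.proj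
      (connection g (constField I p.proj (c q)) (constField I p.proj (d q)) q.proj)) p := by
  let b := Module.finBasis ℝ E
  let γ : _ → _ → M → E := fun i j x => fibreCoord I p.proj x
      (connection g (constField I p.proj (b i)) (constField I p.proj (b j)) x)
  have hγ (i j) : ContMDiffAt I 𝓘(ℝ, E) ∞ (γ i j) p.proj :=
    (smoothAlongAt_iff (b := id) contMDiffAt_id).1
      (smoothAlongAt_connection_constField g p.proj (b i) (b j))
  have hcoord (i) {c : TangentBundle I M → E} (hc : ContMDiffAt I.tangent 𝓘(ℝ, E) ∞ c p) :
      ContMDiffAt I.tangent 𝓘(ℝ, ℝ) ∞ (fun q => b.coord i (c q)) p :=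
    ContMDiffAt.comp p (LinearMap.toContinuousLinearMap (b.coord i)).contMDiff.contMDiffAt hc
  have hsum : ContMDiffAt I.tangent 𝓘(ℝ, E) ∞ (fun q : TangentBundle I M =>
      ∑ j, b.coord j (d q) • ∑ i, b.coord i (c q) • γ i j q.proj) p :=
    contMDiffAt_finsetSum fun j _ => (hcoord j hd).smul (contMDiffAt_finsetSum fun i _ =>
      (hcoord i hc).smul
        (ContMDiffAt.comp p (hγ i j) contMDiff_tangentBundle_proj.contMDiffAt))
  refine hsum.congr_of_eventuallyEq ?_
  filter_upwards [contMDiff_tangentBundle_proj.continuous.continuousAt.preimage_mem_nhds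
    ((tangentTriv I p.proj).open_baseSet.mem_nhds (mem_baseSet_tangentTriv p.proj))] with q hq
  rw [← christoffel_apply g hq]
  conv_lhs => rw [← b.sum_repr (c q), ← b.sum_repr (d q)]
  simp only [map_sum, map_smul, LinearMap.sum_apply, LinearMap.smul_apply]
  rfl

/-- A vector field on `TM` is smooth iff its horizontal and vertical parts are. -/
lemma smoothAlongAt_tangentBundle_iff {X : ∀ p : TangentBundle I M, TangentSpace I.tangent p}
    {p : TangentBundle I M} :
    SmoothAlongAt I.tangent I.tangent id X p ↔
      SmoothAlongAt I I.tangent (fun q : TangentBundle I M => q.proj) (fun q => dproj q (X q)) p ∧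
      SmoothAlongAt I I.tangent (fun q : TangentBundle I M => q.proj)
        (fun q => connector g q (X q)) p := by
  have hproj : ContMDiffAt I.tangent I ∞ (fun q : TangentBundle I M => q.proj) p :=
    contMDiff_tangentBundle_proj.contMDiffAt
  have hp := mem_baseSet_tangentTriv (I := I) p.proj
  have hev : ∀ᶠ q : TangentBundle I M in 𝓝 p, q.proj ∈ (tangentTriv I p.proj).baseSet :=
    hproj.continuousAt.preimage_mem_nhds ((tangentTriv I p.proj).open_baseSet.mem_nhds hp)
  have hconn : (fun q => fibreCoord I p.proj q.proj (connector g q (X q))) =ᶠ[𝓝 p]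
      fun q => dyCoord p.proj q (X q) + fibreCoord I p.proj q.proj (connection g
        (constField I p.proj (fibreCoord I p.proj q.proj (dproj q (X q))))
        (constField I p.proj (yCoord I p.proj q)) q.proj) := by
    filter_upwards [hev] with q hq
    exact fibreCoord_connector g hq (X q)
  constructor
  · intro hX
    have h1 : SmoothAlongAt I I.tangent (fun q : TangentBundle I M => q.proj)
      (fun q => dproj q (X q)) p := contMDiffAt_mfderiv_apply (b := id) hproj hX
    refine ⟨h1, (smoothAlongAt_iff hproj).2 ?_⟩
    refine ContMDiffAt.congr_of_eventuallyEq ?_ hconn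
    exact (contMDiffAt_mfderiv_vec (b := id) (contMDiffAt_yCoord hp) hX).add
      (contMDiffAt_christoffel_term g ((smoothAlongAt_iff hproj).1 h1) (contMDiffAt_yCoord hp))
  · rintro ⟨h1, h2⟩
    rw [smoothAlongAt_iff hproj] at h1 h2
    have h3 := contMDiffAt_christoffel_term g h1 (contMDiffAt_yCoord hp)
    -- Subtracting Γ(dx, y) from the vertical part recovers dy; then dx and dy are the components of
    -- X in the chart of TM.
    have h4 : ContMDiffAt I.tangent 𝓘(ℝ, E) ∞ (fun q => dyCoord p.proj q (X q)) p := by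
      refine (h2.sub h3).congr_of_eventuallyEq ?_
      filter_upwards [hconn] with q hq
      exact eq_sub_of_add_eq hq.symm
    refine (smoothAlongAt_iff (b := id) contMDiffAt_id).2 ?_
    refine (h1.prodMk_space h4).congr_of_eventuallyEq ?_
    filter_upwards [hev] with q hq
    rw [← mfderiv_extChartAt_tangentBundle p q hq]
    exact congrArg (fun L => L (X q)) (TangentBundle.continuousLinearMapAt_trivializationAt
      ((TangentBundle.mem_chart_source_iff q p).2 hq))

end SmoothSplitting

/-! ### The tangent bundle is Hausdorff. -/

section Hausdorff

variable {E : Type*} [NormedAddCommGroup E] [NormedSpace ℝ E]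
  {H : Type*} [TopologicalSpace H] {I : ModelWithCorners ℝ E H}
  {N : Type*} [TopologicalSpace N] [ChartedSpace H N] [IsManifold I ∞ N]

/-- Points over different base points are separated by the projection; points of the same fibre lie
in one trivialization and are separated there. -/
lemma t2Space_tangentBundle [T2Space N] : T2Space (TangentBundle I N) := by
  refine ⟨fun p q hpq => ?_⟩
  by_cases h : p.proj = q.proj
  · let e := tangentTriv I p.proj
    have hp : p ∈ e.source := e.mem_source.2 (mem_baseSet_tangentTriv p.proj)
    have hq : q ∈ e.source := e.mem_source.2 (h ▸ mem_baseSet_tangentTriv p.proj)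
    obtain ⟨U, V, hU, hV, hpU, hqV, hUV⟩ := t2_separation (e.injOn.ne hp hq hpq)
    exact ⟨e.source ∩ e ⁻¹' U, e.source ∩ e ⁻¹' V,
      e.continuousOn.isOpen_inter_preimage e.open_source hU,
      e.continuousOn.isOpen_inter_preimage e.open_source hV, ⟨hp, hpU⟩, ⟨hq, hqV⟩,
      (hUV.preimage e).mono inter_subset_right inter_subset_right⟩
  · exact separated_by_continuous (FiberBundle.continuous_proj E (TangentSpace I)) h

end Hausdorff

/-! ### Global extension of vectors, and differentiability of bilinear forms. -/

section Extension

variable {E : Type*} [NormedAddCommGroup E] [NormedSpace ℝ E] [FiniteDimensional ℝ E]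
  {H : Type*} [TopologicalSpace H] {I : ModelWithCorners ℝ E H}
  {N : Type*} [TopologicalSpace N] [ChartedSpace H N] [IsManifold I ∞ N]

/-- The local extension is multiplied by a bump function supported where it is smooth; the Hausdorff
property makes the bump function globally smooth. -/
lemma exists_isSmoothField_eq [T2Space N] (p : N) (v : TangentSpace I p) :
    ∃ X, IsSmoothField I X ∧ X p = v := by
  have : ContMDiffVectorBundle ∞ E (TangentSpace I : N → Type _) I :=
    TangentBundle.contMDiffVectorBundle (h := inferInstanceAs (IsManifold I ∞ N))
  obtain ⟨s, hs, hv⟩ := FiberBundle.exists_contMDiffOn_extend (k := ∞) I E v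
  obtain ⟨ψ, -, hψ⟩ := (SmoothBumpFunction.nhds_basis_tsupport (I := I) p).mem_iff.1
    (interior_mem_nhds.2 hs)
  refine ⟨fun q => ψ q • FiberBundle.extend E v q, ?_, ?_⟩
  · exact ContMDiffOn.smul_section_of_tsupport ψ.contMDiff.contMDiffOn isOpen_interior hψ
      (hv.mono interior_subset)
  · simp

/-- A field of bilinear forms which is smooth on smooth fields is differentiable on differentiable
fields. -/
lemma IsSmoothForm.mdifferentiableAt {h : ∀ p : N, TangentSpace I p → TangentSpace I p → ℝ}
    (hs : IsSmoothForm h) (hadd : ∀ p u v w, h p (u + v) w = h p u w + h p v w)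
    (hsmul : ∀ p (c : ℝ) u w, h p (c • u) w = c * h p u w) (hsymm : ∀ p u v, h p u v = h p v u)
    {p : N} {X Y : ∀ q : N, TangentSpace I q} (hX : DiffFieldAt X p) (hY : DiffFieldAt Y p) :
    MDifferentiableAt I 𝓘(ℝ, ℝ) (fun q => h q (X q) (Y q)) p := by
  have hp := mem_baseSet_tangentTriv (I := I) p
  let b := Module.finBasis ℝ E
  let B (q : N) : TangentSpace I q →ₗ[ℝ] TangentSpace I q →ₗ[ℝ] ℝ :=
    LinearMap.mk₂ ℝ (h q) (hadd q) (hsmul q)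
      (fun u v w => by rw [hsymm, hadd, hsymm _ v, hsymm _ w])
      (fun c u v => by rw [hsymm, hsmul, hsymm]; rfl)
  have hcoord (i) {X : ∀ q : N, TangentSpace I q} (hX : DiffFieldAt X p) :
      MDifferentiableAt I 𝓘(ℝ, ℝ) (fun q => b.coord i (fibreCoord I p q (X q))) p :=
    MDifferentiableAt.comp p
      (LinearMap.toContinuousLinearMap (b.coord i)).differentiableAt.mdifferentiableAt
      (mdifferentiableAt_fibreCoord hp hX)
  -- Tensoriality tests fields that are only differentiable. Expanding them in the smooth constant
  -- frame, only the coefficients lose regularity.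
  have hexp (q : N) (hq : q ∈ (tangentTriv I p).baseSet) (v : TangentSpace I q) :
      v = ∑ i, b.coord i (fibreCoord I p q v) • constField I p (b i) q := by
    conv_lhs => rw [← constField_fibreCoord hq v, ← b.sum_repr (fibreCoord I p q v)]
    refine (map_sum ((tangentTriv I p).symmL ℝ q) _ _).trans (Finset.sum_congr rfl fun i _ => ?_)
    exact map_smul ((tangentTriv I p).symmL ℝ q) _ _
  have hform (i j) : MDifferentiableAt I 𝓘(ℝ, ℝ)
      (fun q => h q (constField I p (b i) q) (constField I p (b j) q)) p :=
    (hs p _ _ (smoothAlongAt_constField hp _)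
      (smoothAlongAt_constField hp _)).mdifferentiableAt (by simp)
  have hsum : MDifferentiableAt I 𝓘(ℝ, ℝ) (fun q =>
      ∑ j, b.coord j (fibreCoord I p q (Y q)) • ∑ i, b.coord i (fibreCoord I p q (X q)) •
        h q (constField I p (b i) q) (constField I p (b j) q)) p := by
    have hinner (j) : MDifferentiableAt I 𝓘(ℝ, ℝ) (fun q =>
        ∑ i, b.coord i (fibreCoord I p q (X q)) •
          h q (constField I p (b i) q) (constField I p (b j) q)) p := by
      convert! MDifferentiableAt.sum (t := Finset.univ)
        (fun i _ => (hcoord i hX).smul (hform i j)) using 1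
      funext q
      simp [Finset.sum_apply]
    convert! MDifferentiableAt.sum (t := Finset.univ)
      (fun j _ => (hcoord j hY).smul (hinner j)) using 1
    funext q
    simp [Finset.sum_apply]
  refine hsum.congr_of_eventuallyEq ?_
  filter_upwards [(tangentTriv I p).open_baseSet.mem_nhds hp] with q hq
  change B q (X q) (Y q) = _
  conv_lhs => rw [hexp q hq (X q), hexp q hq (Y q)]
  simp only [map_sum, map_smul, LinearMap.sum_apply, LinearMap.smul_apply]
  rfl

end Extension

/-! ### Natural tensors written through `dproj` and `connector`. -/

section Formulas

variable {E : Type*} [NormedAddCommGroup E] [NormedSpace ℝ E]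
  {H : Type*} [TopologicalSpace H] {I : ModelWithCorners ℝ E H}
  {M : Type*} [TopologicalSpace M] [ChartedSpace H M] [IsManifold I ∞ M]
  (g : ContMDiffRiemannianMetric I ∞ E (fun x : M => TangentSpace I x))

lemma contMDiffAt_snd_tangentBundle (p : TangentBundle I M) :
    SmoothAlongAt I I.tangent (fun q : TangentBundle I M => q.proj) (fun q => q.snd) p :=
  contMDiffAt_id

lemma naturalG_apply (k : CoeffG) (p : TangentBundle I M) (ξ η : TangentSpace I.tangent p) :
    naturalG g k p ξ η
      = (k.c₁ (energy g p) * metricForm g p.proj (dproj p ξ) (dproj p η)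
          + k.d₁ (energy g p) * metricForm g p.proj (dproj p ξ) p.snd
            * metricForm g p.proj (dproj p η) p.snd)
        + (k.c₂ (energy g p) * metricForm g p.proj (connector g p ξ) (connector g p η)
          + k.d₂ (energy g p) * metricForm g p.proj (connector g p ξ) p.snd
            * metricForm g p.proj (connector g p η) p.snd)
        + (k.c₃ (energy g p) * metricForm g p.proj (connector g p ξ) (dproj p η)
          + k.d₃ (energy g p) * metricForm g p.proj (connector g p ξ) p.snd
            * metricForm g p.proj (dproj p η) p.snd)
        + (k.c₃ (energy g p) * metricForm g p.proj (connector g p η) (dproj p ξ)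
          + k.d₃ (energy g p) * metricForm g p.proj (connector g p η) p.snd
            * metricForm g p.proj (dproj p ξ) p.snd) := rfl

/-- The horizontal part of `naturalJ`. -/
lemma dproj_naturalJ (j : CoeffJ) (p : TangentBundle I M) (ξ : TangentSpace I.tangent p) :
    dproj p (naturalJ g j p ξ)
      = (j.a₄ (energy g p) • dproj p ξ
          + (j.b₄ (energy g p) * metricForm g p.proj (dproj p ξ) p.snd) •
            (p.snd : TangentSpace I p.proj))
        + ((-j.a₂ (energy g p)) • connector g p ξ
          + (-j.b₂ (energy g p) * metricForm g p.proj (connector g p ξ) p.snd) •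
            (p.snd : TangentSpace I p.proj)) := by
  simp only [naturalJ, sub_eq_add_neg, ← neg_smul, dproj_add, dproj_smul, dproj_verticalLift,
    dproj_horizontalLift,
    smul_zero, zero_add, neg_mul, add_assoc]

/-- The energy density is smooth and, by positivity of g, takes values in [0, ∞), so smoothness of
the coefficient on that closed half-line suffices, even along the zero section. -/
lemma contMDiff_comp_energy {a : ℝ → ℝ} (ha : ContDiffOn ℝ ∞ a (Ici 0)) :
    ContMDiff I.tangent 𝓘(ℝ, ℝ) ∞ (fun q : TangentBundle I M => a (energy g q)) := by
  have h1 : ContMDiff I.tangent 𝓘(ℝ, ℝ) ∞ (energy g) := fun p =>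
    (contMDiffAt_metricForm g (contMDiffAt_snd_tangentBundle p)
      (contMDiffAt_snd_tangentBundle p)).div_const 2
  refine ha.contMDiffOn.comp_contMDiff h1 fun q => ?_
  change (0 : ℝ) ≤ metricForm g q.proj q.snd q.snd / 2
  refine div_nonneg ?_ zero_le_two
  by_cases hq : q.snd = 0
  · rw [hq]
    exact (congrArg (fun L => L 0) (map_zero (g.inner q.proj))).ge
  · exact (g.pos _ _ hq).le

end Formulas

/-! ### Regularity of `naturalG` and `naturalJ`. -/

section Natural

variable {E : Type*} [NormedAddCommGroup E] [NormedSpace ℝ E] [FiniteDimensional ℝ E]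
  {H : Type*} [TopologicalSpace H] {I : ModelWithCorners ℝ E H}
  {M : Type*} [TopologicalSpace M] [ChartedSpace H M] [IsManifold I ∞ M]
  (g : ContMDiffRiemannianMetric I ∞ E (fun x : M => TangentSpace I x))

lemma isSmoothForm_naturalG (k : CoeffG) : IsSmoothForm (naturalG g k) := by
  intro p X Y hX hY
  obtain ⟨hu, hw⟩ := (smoothAlongAt_tangentBundle_iff g).1 hX
  obtain ⟨hu', hw'⟩ := (smoothAlongAt_tangentBundle_iff g).1 hY
  have hy := contMDiffAt_snd_tangentBundle p
  have hc {a : ℝ → ℝ} (ha : ContDiffOn ℝ ∞ a (Ici 0)) :=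
    (contMDiff_comp_energy g ha).contMDiffAt (x := p)
  have term {c d : ℝ → ℝ} (hc' : ContDiffOn ℝ ∞ c (Ici 0)) (hd' : ContDiffOn ℝ ∞ d (Ici 0))
      {a b : ∀ q : TangentBundle I M, TangentSpace I q.proj}
      (ha : SmoothAlongAt I I.tangent (fun q : TangentBundle I M => q.proj) a p)
      (hb : SmoothAlongAt I I.tangent (fun q : TangentBundle I M => q.proj) b p) :=
    ((hc hc').mul (contMDiffAt_metricForm g ha hb)).add
      (((hc hd').mul (contMDiffAt_metricForm g ha hy)).mul (contMDiffAt_metricForm g hb hy))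
  exact (((term k.smooth_c₁ k.smooth_d₁ hu hu').add (term k.smooth_c₂ k.smooth_d₂ hw hw')).add
    (term k.smooth_c₃ k.smooth_d₃ hw hu')).add (term k.smooth_c₃ k.smooth_d₃ hw' hu)

lemma isMetric_naturalG (k : CoeffG) (hG : IsNondegenerate I.tangent (naturalG g k)) :
    IsMetric (naturalG g k) := by
  have hg := isMetric_metricForm g
  have hadd : ∀ p u v w, naturalG g k p (u + v) w = naturalG g k p u w + naturalG g k p v w := by
    intro p u v w
    simp only [naturalG_apply, dproj_add, connector_add, hg.add_left, hg.add_right]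
    ring
  have hsmul : ∀ p (c : ℝ) u w, naturalG g k p (c • u) w = c * naturalG g k p u w := by
    intro p c u w
    simp only [naturalG_apply, dproj_smul, connector_smul, hg.smul_left, hg.smul_right]
    ring
  have hsymm : ∀ p u v, naturalG g k p u v = naturalG g k p v u := by
    intro p u v
    simp only [naturalG_apply]
    rw [hg.symm p.proj (dproj p u) (dproj p v),
      hg.symm p.proj (connector g p u) (connector g p v)]
    ring
  exact ⟨hadd, hsmul, hsymm, hG, fun p X Y hX hY =>
    (isSmoothForm_naturalG g k).mdifferentiableAt hadd hsmul hsymm hX hY⟩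

/-- The vertical part of `naturalJ`. -/
lemma connector_naturalJ (j : CoeffJ) (p : TangentBundle I M) (ξ : TangentSpace I.tangent p) :
    connector g p (naturalJ g j p ξ)
      = (j.a₁ (energy g p) • dproj p ξ
          + (j.b₁ (energy g p) * metricForm g p.proj (dproj p ξ) p.snd) •
            (p.snd : TangentSpace I p.proj))
        + (j.a₃ (energy g p) • connector g p ξ
          + (j.b₃ (energy g p) * metricForm g p.proj (connector g p ξ) p.snd) •
            (p.snd : TangentSpace I p.proj)) := by
  simp only [naturalJ, sub_eq_add_neg, ← neg_smul, connector_add, connector_smul, connector_verticalLift,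
    connector_horizontalLift,
    smul_zero, add_zero, zero_add, add_assoc]

lemma isSmoothField_naturalJ (j : CoeffJ)
    {X : ∀ p : TangentBundle I M, TangentSpace I.tangent p} (hX : IsSmoothField I.tangent X) :
    IsSmoothField I.tangent (fun p => naturalJ g j p (X p)) := by
  intro p
  obtain ⟨hu, hw⟩ := (smoothAlongAt_tangentBundle_iff g).1 (hX p)
  have hy := contMDiffAt_snd_tangentBundle p
  have term {a b : ℝ → ℝ} (ha : ContDiffOn ℝ ∞ a (Ici 0)) (hb : ContDiffOn ℝ ∞ b (Ici 0))
      {v : ∀ q : TangentBundle I M, TangentSpace I q.proj}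
      (hv : SmoothAlongAt I I.tangent (fun q : TangentBundle I M => q.proj) v p) :=
    smoothAlongAt_add (smoothAlongAt_smul ((contMDiff_comp_energy g ha).contMDiffAt (x := p)) hv)
      (smoothAlongAt_smul (((contMDiff_comp_energy g hb).contMDiffAt (x := p)).mul
        (contMDiffAt_metricForm g hv hy)) hy)
  refine (smoothAlongAt_tangentBundle_iff g).2 ⟨?_, ?_⟩
  · simp only [dproj_naturalJ]
    exact smoothAlongAt_add (term j.smooth_a₄ j.smooth_b₄ hu)
      (term j.smooth_a₂.neg j.smooth_b₂.neg hw)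
  · simp only [connector_naturalJ]
    exact smoothAlongAt_add (term j.smooth_a₁ j.smooth_b₁ hu) (term j.smooth_a₃ j.smooth_b₃ hw)

end Natural

end NaturalLift

end

/-! ### The general equivalence applied to TM. -/

theorem mainTheorem4 (n : ℕ)
    {M : Type*} [TopologicalSpace M] [T2Space M] [SecondCountableTopology M]
    [ChartedSpace (EuclideanSpace ℝ (Fin n)) M] [IsManifold (𝓡 n) ∞ M]
    (g : ContMDiffRiemannianMetric (𝓡 n) ∞ (EuclideanSpace ℝ (Fin n))
      (fun x : M => TangentSpace (𝓡 n) x))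
    (j : NaturalLift.CoeffJ) (k : NaturalLift.CoeffG)
    (hJ : NaturalLift.IsAlmostComplex (𝓡 n).tangent (NaturalLift.naturalJ g j))
    (hG : NaturalLift.IsNondegenerate (𝓡 n).tangent (NaturalLift.naturalG g k))
    (hGJ : NaturalLift.IsAntiHermitian (𝓡 n).tangent
      (NaturalLift.naturalG g k) (NaturalLift.naturalJ g j)) :
    NaturalLift.IsComplexAntiHermitian (𝓡 n).tangent
        (NaturalLift.naturalG g k) (NaturalLift.naturalJ g j) ↔
      NaturalLift.IsIntegrable (𝓡 n).tangent (NaturalLift.naturalJ g j) := by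
  have : T2Space (TangentBundle (𝓡 n) M) := NaturalLift.t2Space_tangentBundle
  exact NaturalLift.isComplexAntiHermitian_iff_isIntegrable (NaturalLift.isMetric_naturalG g k hG)
    hJ hGJ (fun _ hX => NaturalLift.isSmoothField_naturalJ g j hX)
    NaturalLift.exists_isSmoothField_eq
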